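/- Let $a>0$, $c>0$, $x_0,y_0,z_0\in\mathbb R$, and let $B=\{(x',y',z'):\ ((x'-x_0)^2+(y'-y_0)^2)/a^2+(z'-z_0)^2/c^2\le 1\}$ be the spheroid with centre $(x_0,y_0,z_0)$, equatorial semiaxis $a$ and vertical semiaxis $c$, of constant density $\rho$; the $z$-axis points vertically downward. Let $(x,y,0)\notin B$, and let $$V_z(x,y,0)=\gamma\rho\iiint_B \frac{z'}{\big((x-x')^2+(y-y')^2+z'^2\big)^{3/2}}\,dx'\,dy'\,dz'$$ be the $z$-component of the gravitational intensity $\gamma\rho\iiint_B \frac{Q-P}{|Q-P|^3}\,dQ$ of $B$ at $P=(x,y,0)$ (the integral converges absolutely), where $\gamma$ is the gravitational constant. Put $\varepsilon=c/a$ and $r=\sqrt{(x-x_0)^2+(y-y_0)^2+z_0^2}$; then $r>0$. (a) Oblate spheroid. If $\varepsilon<1$, put $e=\sqrt{1-\varepsilon^2}>0$, $q=ea/r$, $\tau=\frac12\Big[1-q^2+\sqrt{(1-q^2)^2+4q^2z_0^2/r^2}\Big]$, $p=q/\sqrt\tau$. Then $\tau>0$ and $$V_z(x,y,0)=4\pi\gamma\rho\,\frac{\varepsilon}{e^3}\,(p-\arctan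 p)\,z_0 .$$ (b) Prolate spheroid. If $\varepsilon>1$, put $e=\sqrt{\varepsilon^2-1}>0$, $q=ea/r$, $t=\frac12\Big\{1-q^2+\sqrt{(1-q^2)^2+4q^2[(x-x_0)^2+(y-y_0)^2]/r^2}\Big\}$, $p=q/\sqrt t$. Then $t>0$ and $$V_z(x,y,0)=4\pi\gamma\rho\,\frac{\varepsilon}{e^3}\left[\ln\!\left(p+\sqrt{1+p^2}\right)-\frac{p}{\sqrt{1+p^2}}\right]z_0 .$$ (c) Sphere. If $\varepsilon=1$, then $$V_z(x,y,0)=\frac43\pi\gamma\rho a^3\,\frac{z_0}{r^3}.$$ -/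

import Mathlib

open MeasureTheory

/-- The solid ellipsoid with centre `C` and semiaxes `a`, `b`, `c` parallel to the axes `x`, `y`, `z`
(the body together with its bounding surface). -/
def ellipsoid (a b c : ℝ) (C : EuclideanSpace ℝ (Fin 3)) : Set (EuclideanSpace ℝ (Fin 3)) :=
  {Q | (Q 0 - C 0) ^ 2 / a ^ 2 + (Q 1 - C 1) ^ 2 / b ^ 2 + (Q 2 - C 2) ^ 2 / c ^ 2 ≤ 1}

/-- The solid spheroid: an ellipsoid of revolution about the vertical line through its centre `C`,
with equatorial semiaxis `a` and vertical semiaxis `c`. -/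
def spheroid (a c : ℝ) (C : EuclideanSpace ℝ (Fin 3)) : Set (EuclideanSpace ℝ (Fin 3)) :=
  ellipsoid a a c C

/-- Newton's law: the attraction (per unit mass) at the point `P` by an element of mass at `Q`
with density `ρ Q`, for gravitational constant `1`; it points from `P` towards `Q` if `ρ Q > 0`. -/
noncomputable def newtonIntegrand (ρ : EuclideanSpace ℝ (Fin 3) → ℝ)
    (P Q : EuclideanSpace ℝ (Fin 3)) : EuclideanSpace ℝ (Fin 3) :=
  (ρ Q / ‖Q - P‖ ^ 3) • (Q - P)

/-- The gravitational intensity at the point `P` of the body `B` with density `ρ`, where `γ` is the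
gravitational constant. -/
noncomputable def gravitationalIntensity (γ : ℝ) (ρ : EuclideanSpace ℝ (Fin 3) → ℝ)
    (B : Set (EuclideanSpace ℝ (Fin 3))) (P : EuclideanSpace ℝ (Fin 3)) :
    EuclideanSpace ℝ (Fin 3) :=
  γ • ∫ Q in B, newtonIntegrand ρ P Q

/-- The `z`-component of the gravitational intensity. -/
noncomputable def zIntensity (γ : ℝ) (ρ : EuclideanSpace ℝ (Fin 3) → ℝ)
    (B : Set (EuclideanSpace ℝ (Fin 3))) (P : EuclideanSpace ℝ (Fin 3)) : ℝ :=
  gravitationalIntensity γ ρ B P 2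

/-! Scaling the spheroid to the unit ball turns `V_z` into `γρa²c` times `ballAttraction`, the
integral over the ball of the kernel `K(p) = p₂ (∑ pⱼ²)^(-3/2)` at `p = c + A U`, with `c` the
displacement from `P` to the centre and `A` the semiaxes. Both may be complex, as long as `∑ pⱼ²`
avoids the cut of the principal power.

The engine is Maclaurin's theorem, `ballAttraction_eq_of_confocal`. Along a confocal path, where `Aᵢ
Aᵢ' = k` for every `i`, the derivative of the integral is `∑ Aᵢ' ∫ Uᵢ ∂ᵢK`. Integration by parts
against the weight `1 - |U|²`, which vanishes on the sphere, makes this `(k/2) ∫ (1 - |U|²) ΔK = 0`.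

Hence a body may be shrunk to its focal set: a sphere to its centre, a prolate spheroid to a
segment, an oblate one to a disc. A further confocal path with a complex semiaxis turns the disc of
radius `f` into the segment with semiaxis `if`, so one elementary integral with weight `π(1 - s²)`
serves both cases, giving a real logarithm or an arctangent (`integral_focal_segment_eq_log`). The
parameters `τ` and `t` of the theorem encode the confocal spheroid through `P`. -/

/-! ### Slicing and integration by parts on the unit ball -/

/-- The closed Euclidean unit ball in coordinates. -/
def coordBall (n : ℕ) : Set (Fin n → ℝ) := {U | ∑ i, U i ^ 2 ≤ 1}

theorem isCompact_coordBall (n : ℕ) : IsCompact (coordBall n) := by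
  apply Metric.isCompact_of_isClosed_isBounded
  · exact isClosed_le (by fun_prop) continuous_const
  · refine (Metric.isBounded_closedBall (x := (0 : Fin n → ℝ)) (r := 1)).subset fun U hU => ?_
    rw [mem_closedBall_zero_iff, pi_norm_le_iff_of_nonneg zero_le_one]
    intro i
    have h1 : U i ^ 2 ≤ ∑ i, U i ^ 2 :=
      Finset.single_le_sum (f := fun i => U i ^ 2) (fun j _ => sq_nonneg _) (Finset.mem_univ i)
    have h2 : U i ^ 2 ≤ 1 := h1.trans hU
    rw [Real.norm_eq_abs]
    exact (sq_le_one_iff_abs_le_one _).1 h2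

theorem insertNth_mem_coordBall {n : ℕ} (i : Fin (n + 1)) (s : ℝ) (y : Fin n → ℝ) :
    i.insertNth (α := fun _ => ℝ) s y ∈ coordBall (n + 1) ↔ s ^ 2 ≤ 1 - ∑ j, y j ^ 2 := by
  simp only [coordBall, Set.mem_ofPred_eq, Fin.sum_univ_succAbove _ i, Fin.insertNth_apply_same,
    Fin.insertNth_apply_succAbove]
  constructor <;> intro h <;> linarith

theorem integrable_indicator_coordBall_insertNth {n : ℕ} (i : Fin (n + 1))
    {F : (Fin (n + 1) → ℝ) → ℂ} (hF : ContinuousOn F (coordBall (n + 1))) :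
    Integrable (fun z : ℝ × (Fin n → ℝ) =>
      (coordBall (n + 1)).indicator F (i.insertNth (α := fun _ => ℝ) z.1 z.2)) := by
  have hI : Integrable ((coordBall (n + 1)).indicator F) :=
    (integrable_indicator_iff (isCompact_coordBall _).measurableSet).2
      (hF.integrableOn_compact (isCompact_coordBall _))
  exact (volume_preserving_piFinSuccAbove (fun _ => ℝ) i).symm.integrable_comp_of_integrable hI

theorem setIntegral_coordBall_eq_integral_insertNth {n : ℕ} (i : Fin (n + 1))
    (F : (Fin (n + 1) → ℝ) → ℂ) :
    ∫ U in coordBall (n + 1), F U = ∫ z : ℝ × (Fin n → ℝ),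
      (coordBall (n + 1)).indicator F (i.insertNth (α := fun _ => ℝ) z.1 z.2) := by
  rw [← integral_indicator (isCompact_coordBall _).measurableSet]
  exact ((volume_preserving_piFinSuccAbove (fun _ => ℝ) i).symm.integral_comp'
    ((coordBall (n + 1)).indicator F)).symm

/-- Slicing the ball into segments parallel to the `i`-th axis. -/
theorem setIntegral_coordBall_eq_segments {n : ℕ} (i : Fin (n + 1))
    {F : (Fin (n + 1) → ℝ) → ℂ} (hF : ContinuousOn F (coordBall (n + 1))) :
    ∫ U in coordBall (n + 1), F U = ∫ y : Fin n → ℝ, ∫ s in {s : ℝ | s ^ 2 ≤ 1 - ∑ j, y j ^ 2},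
      F (i.insertNth (α := fun _ => ℝ) s y) := by
  rw [setIntegral_coordBall_eq_integral_insertNth i, Measure.volume_eq_prod,
    integral_prod_symm _ (integrable_indicator_coordBall_insertNth i hF)]
  refine integral_congr_ae (.of_forall fun y => ?_)
  simp only
  rw [← integral_indicator (measurableSet_le (by fun_prop) (by fun_prop))]
  congr 1
  ext s
  by_cases h : s ^ 2 ≤ 1 - ∑ j, y j ^ 2
  · rw [Set.indicator_of_mem ((insertNth_mem_coordBall i s y).2 h),
      Set.indicator_of_mem (by exact h)]
  · rw [Set.indicator_of_notMem (mt (insertNth_mem_coordBall i s y).1 h),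
      Set.indicator_of_notMem (by exact h)]

/-- Slicing the ball into parallel balls orthogonal to the `i`-th axis. -/
theorem setIntegral_coordBall_eq_slices {n : ℕ} (i : Fin (n + 1))
    {F : (Fin (n + 1) → ℝ) → ℂ} (hF : ContinuousOn F (coordBall (n + 1))) :
    ∫ U in coordBall (n + 1), F U = ∫ s : ℝ, ∫ y in {y : Fin n → ℝ | ∑ j, y j ^ 2 ≤ 1 - s ^ 2},
      F (i.insertNth (α := fun _ => ℝ) s y) := by
  rw [setIntegral_coordBall_eq_integral_insertNth i, Measure.volume_eq_prod,
    integral_prod _ (integrable_indicator_coordBall_insertNth i hF)]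
  refine integral_congr_ae (.of_forall fun s => ?_)
  simp only
  rw [← integral_indicator (measurableSet_le (by fun_prop) (by fun_prop))]
  congr 1
  ext y
  have hiff : s ^ 2 ≤ 1 - ∑ j, y j ^ 2 ↔ ∑ j, y j ^ 2 ≤ 1 - s ^ 2 := by
    constructor <;> intro h <;> linarith
  by_cases h : ∑ j, y j ^ 2 ≤ 1 - s ^ 2
  · rw [Set.indicator_of_mem ((insertNth_mem_coordBall i s y).2 (hiff.2 h)),
      Set.indicator_of_mem (by exact h)]
  · rw [Set.indicator_of_notMem (fun h' => h (hiff.1 ((insertNth_mem_coordBall i s y).1 h'))),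
      Set.indicator_of_notMem (by exact h)]

theorem setOf_sq_le_eq_Icc {S : ℝ} (hS : 0 ≤ S) :
    {s : ℝ | s ^ 2 ≤ S} = Set.Icc (-√S) (√S) := by
  ext s
  exact Real.sq_le hS

/-- The integrand is the derivative of `(S - s²) g`, which vanishes at both ends `±√S`. -/
theorem setIntegral_weight_deriv_eq_zero (S : ℝ) (g g' : ℝ → ℂ)
    (hg : ∀ s, s ^ 2 ≤ S → HasDerivAt g (g' s) s) (hg' : ContinuousOn g' {s | s ^ 2 ≤ S}) :
    ∫ s in {s : ℝ | s ^ 2 ≤ S}, (((S - s ^ 2 : ℝ) : ℂ) * g' s - 2 * (s : ℂ) * g s) = 0 := by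
  rcases lt_or_ge S 0 with hS | hS
  · have : {s : ℝ | s ^ 2 ≤ S} = ∅ := by
      ext s
      simp only [Set.mem_ofPred_eq, Set.mem_empty_iff_false, iff_false, not_le]
      exact hS.trans_le (sq_nonneg s)
    rw [this, setIntegral_empty]
  · have hset := setOf_sq_le_eq_Icc hS
    have hle : -√S ≤ √S := by linarith [Real.sqrt_nonneg S]
    have hgc : ContinuousOn g {s | s ^ 2 ≤ S} :=
      fun s hs => (hg s hs).continuousAt.continuousWithinAt
    rw [hset] at hg' hgc ⊢
    rw [integral_Icc_eq_integral_Ioc, ← intervalIntegral.integral_of_le hle,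
      intervalIntegral.integral_eq_sub_of_hasDerivAt
        (f := fun s : ℝ => ((S - s ^ 2 : ℝ) : ℂ) * g s)]
    · simp [Real.sq_sqrt hS]
    · intro s hs
      rw [Set.uIcc_of_le hle, ← hset] at hs
      have h1 : HasDerivAt (fun s : ℝ => S - s ^ 2) (-(2 * s)) s := by
        simpa using (hasDerivAt_pow 2 s).const_sub S
      refine (h1.ofReal_comp.mul (hg s hs)).congr_deriv ?_
      push_cast
      ring
    · refine ContinuousOn.intervalIntegrable ?_
      rw [Set.uIcc_of_le hle]
      fun_prop

/-- Integration by parts on the ball with the weight `1 - ∑ U j ^ 2`, vanishing on the sphere. -/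
theorem setIntegral_coordBall_weight_deriv_eq_zero {n : ℕ} (i : Fin (n + 1))
    (g g' : (Fin (n + 1) → ℝ) → ℂ)
    (hg : ∀ U ∈ coordBall (n + 1), HasDerivAt (fun s => g (Function.update U i s)) (g' U) (U i))
    (hgc : ContinuousOn g (coordBall (n + 1))) (hg' : ContinuousOn g' (coordBall (n + 1))) :
    ∫ U in coordBall (n + 1), (((1 - ∑ j, U j ^ 2 : ℝ) : ℂ) * g' U - 2 * (U i : ℂ) * g U) = 0 := by
  rw [setIntegral_coordBall_eq_segments i (by fun_prop)]
  refine integral_eq_zero_of_ae (.of_forall fun y => ?_)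
  have key := setIntegral_weight_deriv_eq_zero (1 - ∑ j, y j ^ 2)
    (fun s => g (i.insertNth (α := fun _ => ℝ) s y))
    (fun s => g' (i.insertNth (α := fun _ => ℝ) s y)) ?_ ?_
  · rw [Pi.zero_apply, ← key]
    refine integral_congr_ae (.of_forall fun s => ?_)
    simp only [Fin.sum_univ_succAbove _ i, Fin.insertNth_apply_same,
      Fin.insertNth_apply_succAbove]
    congr 3
    ring
  · intro s hs
    simpa using hg _ ((insertNth_mem_coordBall i s y).2 hs)
  · refine hg'.comp (Continuous.continuousOn ?_) fun s hs => (insertNth_mem_coordBall i s y).2 hs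
    fun_prop

/-- Differentiation under the integral sign, in integrated form. -/
theorem setIntegral_eq_of_deriv_integral_eq_zero {E : Type*} [TopologicalSpace E] [T2Space E]
    [SecondCountableTopology E] [MeasurableSpace E] [BorelSpace E] {μ : Measure E} [SFinite μ]
    [IsFiniteMeasureOnCompacts μ] {K : Set E} (hK : IsCompact K) (F F' : ℝ → E → ℂ)
    {a b : ℝ} (hab : a ≤ b)
    (hd : ∀ t ∈ Set.Icc a b, ∀ U ∈ K, HasDerivAt (fun t => F t U) (F' t U) t)
    (hF : ∀ t ∈ Set.Icc a b, ContinuousOn (F t) K)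
    (hF' : ContinuousOn (Function.uncurry F') (Set.Icc a b ×ˢ K))
    (h0 : ∀ t ∈ Set.Icc a b, ∫ U in K, F' t U ∂μ = 0) :
    ∫ U in K, F a U ∂μ = ∫ U in K, F b U ∂μ := by
  have ha := hF a (Set.left_mem_Icc.2 hab)
  have hb := hF b (Set.right_mem_Icc.2 hab)
  rw [eq_comm, ← sub_eq_zero, ← integral_sub (hb.integrableOn_compact hK)
    (ha.integrableOn_compact hK)]
  have h1 : ∫ U in K, (F b U - F a U) ∂μ = ∫ U in K, (∫ t in Set.Icc a b, F' t U) ∂μ := by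
    refine setIntegral_congr_fun hK.measurableSet fun U hU => ?_
    rw [integral_Icc_eq_integral_Ioc, ← intervalIntegral.integral_of_le hab,
      intervalIntegral.integral_eq_sub_of_hasDerivAt (f := fun t => F t U)]
    · intro t ht
      rw [Set.uIcc_of_le hab] at ht
      exact hd t ht U hU
    · refine ContinuousOn.intervalIntegrable ?_
      rw [Set.uIcc_of_le hab]
      exact hF'.comp (f := fun t => (t, U)) (by fun_prop) fun t ht => ⟨ht, hU⟩
  -- After Fubini the inner integral is over `K` at fixed `t`, which is zero by `h0`.
  rw [h1, integral_integral_swap]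
  · rw [setIntegral_congr_fun measurableSet_Icc h0]
    simp
  · have h2 : IntegrableOn (Function.uncurry F') (Set.Icc a b ×ˢ K) (volume.prod μ) := by
      exact hF'.integrableOn_compact (isCompact_Icc.prod hK)
    rw [IntegrableOn, ← Measure.prod_restrict] at h2
    exact h2.swap

/-! ### Newton's kernel at complex displacements -/

/-- The `z`-component of Newton's kernel, as a function of a complex displacement. -/
noncomputable def newtonKernel (p : Fin 3 → ℂ) : ℂ := p 2 * (∑ j, p j ^ 2) ^ (-3 / 2 : ℂ)

/-- The `i`-th partial derivative of `newtonKernel`. -/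
noncomputable def newtonKernelPartial (i : Fin 3) (p : Fin 3 → ℂ) : ℂ :=
  (if i = 2 then 1 else 0) * (∑ j, p j ^ 2) ^ (-3 / 2 : ℂ) -
    3 * p i * p 2 * (∑ j, p j ^ 2) ^ (-5 / 2 : ℂ)

/-- The second partial derivative of `newtonKernel` in the `i`-th direction. -/
noncomputable def newtonKernelPartial₂ (i : Fin 3) (p : Fin 3 → ℂ) : ℂ :=
  -(3 * p 2 + 6 * (if i = 2 then 1 else 0) * p i) * (∑ j, p j ^ 2) ^ (-5 / 2 : ℂ) +
    15 * p i ^ 2 * p 2 * (∑ j, p j ^ 2) ^ (-7 / 2 : ℂ)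

/-- Harmonicity of the kernel. Over the common power `-7/2` it is a polynomial identity, hence valid
for complex `p`: the two terms contribute `∓15 p₂ ∑ pⱼ²`. -/
theorem sum_newtonKernelPartial₂_eq_zero (p : Fin 3 → ℂ) (hp : ∑ j, p j ^ 2 ≠ 0) :
    ∑ i, newtonKernelPartial₂ i p = 0 := by
  have h : (∑ j, p j ^ 2) ^ (-5 / 2 : ℂ) = (∑ j, p j ^ 2) * (∑ j, p j ^ 2) ^ (-7 / 2 : ℂ) := by
    rw [show (-5 / 2 : ℂ) = 1 + -7 / 2 by norm_num, Complex.cpow_add _ _ hp, Complex.cpow_one]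
  simp only [newtonKernelPartial₂, h]
  generalize (∑ j, p j ^ 2) ^ (-7 / 2 : ℂ) = w
  simp [Fin.sum_univ_three]
  ring

theorem hasDerivAt_sum_sq_cpow {γ : ℝ → Fin 3 → ℂ} {v : Fin 3 → ℂ} {t : ℝ}
    (hγ : ∀ i, HasDerivAt (fun s => γ s i) (v i) t) (ht : ∑ j, γ t j ^ 2 ∈ Complex.slitPlane)
    (m : ℂ) :
    HasDerivAt (fun s => (∑ j, γ s j ^ 2) ^ m)
      ((2 * ∑ j, γ t j * v j) * (m * (∑ j, γ t j ^ 2) ^ (m - 1))) t := by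
  have h1 : HasDerivAt (fun s => ∑ j, γ s j ^ 2) (2 * ∑ j, γ t j * v j) t := by
    refine (HasDerivAt.fun_sum fun j _ => (hγ j).pow 2).congr_deriv ?_
    rw [Finset.mul_sum]
    refine Finset.sum_congr rfl fun j _ => ?_
    push_cast
    ring
  have h2 : HasDerivAt (fun z : ℂ => z ^ m) (m * (∑ j, γ t j ^ 2) ^ (m - 1) * 1)
      (∑ j, γ t j ^ 2) := (hasDerivAt_id _).cpow_const ht
  have h3 := HasDerivAt.scomp t h2 h1
  rw [mul_one, smul_eq_mul] at h3
  exact h3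

theorem hasDerivAt_newtonKernel {γ : ℝ → Fin 3 → ℂ} {v : Fin 3 → ℂ} {t : ℝ}
    (hγ : ∀ i, HasDerivAt (fun s => γ s i) (v i) t) (ht : ∑ j, γ t j ^ 2 ∈ Complex.slitPlane) :
    HasDerivAt (fun s => newtonKernel (γ s)) (∑ i, v i * newtonKernelPartial i (γ t)) t := by
  refine ((hγ 2).mul (hasDerivAt_sum_sq_cpow hγ ht (-3 / 2))).congr_deriv ?_
  rw [show (-3 / 2 - 1 : ℂ) = -5 / 2 by norm_num]
  simp only [newtonKernelPartial]
  generalize (∑ j, γ t j ^ 2) ^ (-5 / 2 : ℂ) = w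
  generalize (∑ j, γ t j ^ 2) ^ (-3 / 2 : ℂ) = w'
  simp [Fin.sum_univ_three]
  ring

theorem hasDerivAt_newtonKernelPartial (i : Fin 3) {γ : ℝ → Fin 3 → ℂ} {v : ℂ} {t : ℝ}
    (hγ : ∀ j, HasDerivAt (fun s => γ s j) (if j = i then v else 0) t)
    (ht : ∑ j, γ t j ^ 2 ∈ Complex.slitPlane) :
    HasDerivAt (fun s => newtonKernelPartial i (γ s)) (v * newtonKernelPartial₂ i (γ t)) t := by
  have h := ((hasDerivAt_sum_sq_cpow hγ ht (-3 / 2)).const_mul (if i = 2 then 1 else 0)).sub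
    ((((hγ i).const_mul 3).mul (hγ 2)).mul (hasDerivAt_sum_sq_cpow hγ ht (-5 / 2)))
  refine h.congr_deriv ?_
  rw [show (-3 / 2 - 1 : ℂ) = -5 / 2 by norm_num, show (-5 / 2 - 1 : ℂ) = -7 / 2 by norm_num]
  simp only [newtonKernelPartial₂, Pi.mul_apply]
  generalize (∑ j, γ t j ^ 2) ^ (-5 / 2 : ℂ) = w
  generalize (∑ j, γ t j ^ 2) ^ (-7 / 2 : ℂ) = w'
  fin_cases i <;> simp <;> ring

theorem continuousOn_sum_sq_cpow (m : ℂ) :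
    ContinuousOn (fun p : Fin 3 → ℂ => (∑ j, p j ^ 2) ^ m)
      {p | ∑ j, p j ^ 2 ∈ Complex.slitPlane} :=
  ContinuousOn.cpow_const (by fun_prop) fun _ hp => hp

theorem continuousOn_newtonKernel :
    ContinuousOn newtonKernel {p | ∑ j, p j ^ 2 ∈ Complex.slitPlane} := by
  have := continuousOn_sum_sq_cpow (-3 / 2)
  unfold newtonKernel
  fun_prop

theorem continuousOn_newtonKernelPartial (i : Fin 3) :
    ContinuousOn (newtonKernelPartial i) {p | ∑ j, p j ^ 2 ∈ Complex.slitPlane} := by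
  have := continuousOn_sum_sq_cpow (-3 / 2)
  have := continuousOn_sum_sq_cpow (-5 / 2)
  unfold newtonKernelPartial
  fun_prop

theorem continuousOn_newtonKernelPartial₂ (i : Fin 3) :
    ContinuousOn (newtonKernelPartial₂ i) {p | ∑ j, p j ^ 2 ∈ Complex.slitPlane} := by
  have := continuousOn_sum_sq_cpow (-7 / 2)
  have := continuousOn_sum_sq_cpow (-5 / 2)
  unfold newtonKernelPartial₂
  fun_prop

/-! ### Maclaurin's theorem on confocal ellipsoids, with complex semiaxes -/

/-- The displacement to the point with coordinates `U` of the ellipsoid with centre `c` and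
semiaxes `A` (possibly complex). -/
def axisScale (c A : Fin 3 → ℂ) (U : Fin 3 → ℝ) : Fin 3 → ℂ := fun i => c i + A i * U i

/-- The attraction in the `z`-direction, averaged over the ellipsoid with centre `c` and semiaxes
`A`, up to a constant factor. -/
noncomputable def ballAttraction (c A : Fin 3 → ℂ) : ℂ :=
  ∫ U in coordBall 3, newtonKernel (axisScale c A U)

/-- Integration by parts for the `i`-th derivative of the kernel. -/
theorem setIntegral_newtonKernelPartial (c A : Fin 3 → ℂ)
    (hA : ∀ U ∈ coordBall 3, ∑ j, axisScale c A U j ^ 2 ∈ Complex.slitPlane) (i : Fin 3) :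
    ∫ U in coordBall 3, (((1 - ∑ j, U j ^ 2 : ℝ) : ℂ) *
      (A i * newtonKernelPartial₂ i (axisScale c A U)) -
      2 * (U i : ℂ) * newtonKernelPartial i (axisScale c A U)) = 0 := by
  have hc : ContinuousOn (axisScale c A) (coordBall 3) := by
    unfold axisScale
    fun_prop
  refine setIntegral_coordBall_weight_deriv_eq_zero i
    (fun U => newtonKernelPartial i (axisScale c A U)) _ (fun U hU => ?_)
    ((continuousOn_newtonKernelPartial i).comp hc hA)
    (((continuousOn_newtonKernelPartial₂ i).comp hc hA).const_mul _)
  have h := hasDerivAt_newtonKernelPartial i (v := A i) (t := U i)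
    (γ := fun s => axisScale c A (Function.update U i s)) (fun j => ?_) (by simpa using hA U hU)
  · simpa using h
  · by_cases hj : j = i
    · subst hj
      simpa [axisScale] using ((Complex.ofRealCLM.hasDerivAt (x := U j)).const_mul (A j)).const_add (c j)
    · simpa [axisScale, hj] using hasDerivAt_const (U i) (c j + A j * U j)

/-- Confocal ellipsoids attract an exterior point in proportion to their masses. -/
theorem ballAttraction_eq_of_confocal (c : Fin 3 → ℂ) (A A' : ℝ → Fin 3 → ℂ) (k : ℝ → ℂ)
    (hA : ∀ t i, HasDerivAt (fun s => A s i) (A' t i) t) (hA' : Continuous A')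
    (hk : ∀ t i, A t i * A' t i = k t)
    (hs : ∀ t ∈ Set.Icc (0 : ℝ) 1, ∀ U ∈ coordBall 3,
      ∑ j, axisScale c (A t) U j ^ 2 ∈ Complex.slitPlane) :
    ballAttraction c (A 0) = ballAttraction c (A 1) := by
  have hAc : Continuous A := continuous_pi fun i => continuous_iff_continuousAt.2
    fun t => (hA t i).continuousAt
  have hsc : ∀ t, Continuous (axisScale c (A t)) := fun t => by
    unfold axisScale
    fun_prop
  have hjoint : Continuous fun q : ℝ × (Fin 3 → ℝ) => axisScale c (A q.1) q.2 := by
    unfold axisScale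
    fun_prop
  refine setIntegral_eq_of_deriv_integral_eq_zero (isCompact_coordBall 3)
    (fun t U => newtonKernel (axisScale c (A t) U))
    (fun t U => ∑ i, A' t i * U i * newtonKernelPartial i (axisScale c (A t) U))
    zero_le_one ?_ ?_ ?_ ?_
  · intro t ht U hU
    exact hasDerivAt_newtonKernel (γ := fun s => axisScale c (A s) U)
      (fun i => ((hA t i).mul_const (U i : ℂ)).const_add (c i)) (hs t ht U hU)
  · intro t ht
    exact continuousOn_newtonKernel.comp (hsc t).continuousOn (hs t ht)
  · have h1 : ∀ i, ContinuousOn (fun q : ℝ × (Fin 3 → ℝ) =>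
        newtonKernelPartial i (axisScale c (A q.1) q.2)) (Set.Icc (0 : ℝ) 1 ×ˢ coordBall 3) :=
      fun i => (continuousOn_newtonKernelPartial i).comp hjoint.continuousOn
        fun q hq => hs q.1 hq.1 q.2 hq.2
    unfold Function.uncurry
    fun_prop
  · intro t ht
    have hP : ∀ i, ContinuousOn (fun U => newtonKernelPartial i (axisScale c (A t) U))
        (coordBall 3) := fun i =>
      (continuousOn_newtonKernelPartial i).comp (hsc t).continuousOn (hs t ht)
    have hP₂ : ∀ i, ContinuousOn (fun U => newtonKernelPartial₂ i (axisScale c (A t) U))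
        (coordBall 3) := fun i =>
      (continuousOn_newtonKernelPartial₂ i).comp (hsc t).continuousOn (hs t ht)
    have key : ∫ U in coordBall 3, ∑ i, A' t i * (((1 - ∑ j, U j ^ 2 : ℝ) : ℂ) *
        (A t i * newtonKernelPartial₂ i (axisScale c (A t) U)) -
        2 * (U i : ℂ) * newtonKernelPartial i (axisScale c (A t) U)) = 0 := by
      rw [integral_finsetSum]
      · refine Finset.sum_eq_zero fun i _ => ?_
        rw [integral_const_mul, setIntegral_newtonKernelPartial c (A t) (hs t ht), mul_zero]
      · intro i _
        refine ContinuousOn.integrableOn_compact (isCompact_coordBall 3) ?_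
        have := hP i
        have := hP₂ i
        fun_prop
    -- By `Aᵢ Aᵢ' = k` the second-order terms add up to `k (1 - |U|²) ΔK = 0`. What remains is `-2`
    -- times the derivative of the integrand, whence the factor `-1/2`.
    have h2 : ∀ U ∈ coordBall 3, ∑ i, A' t i * U i * newtonKernelPartial i (axisScale c (A t) U) =
        (-1 / 2 : ℂ) * ∑ i, A' t i * (((1 - ∑ j, U j ^ 2 : ℝ) : ℂ) *
        (A t i * newtonKernelPartial₂ i (axisScale c (A t) U)) -
        2 * (U i : ℂ) * newtonKernelPartial i (axisScale c (A t) U)) := by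
      intro U hU
      have h3 := sum_newtonKernelPartial₂_eq_zero _ (Complex.slitPlane_ne_zero (hs t ht U hU))
      have h4 : ∑ i, A' t i * (((1 - ∑ j, U j ^ 2 : ℝ) : ℂ) *
          (A t i * newtonKernelPartial₂ i (axisScale c (A t) U)) -
          2 * (U i : ℂ) * newtonKernelPartial i (axisScale c (A t) U)) =
          ((1 - ∑ j, U j ^ 2 : ℝ) : ℂ) * k t * ∑ i, newtonKernelPartial₂ i (axisScale c (A t) U) -
          2 * ∑ i, A' t i * U i * newtonKernelPartial i (axisScale c (A t) U) := by
        rw [Finset.mul_sum, Finset.mul_sum, ← Finset.sum_sub_distrib]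
        refine Finset.sum_congr rfl fun i _ => ?_
        rw [← hk t i]
        ring
      rw [h4, h3]
      ring
    rw [setIntegral_congr_fun (isCompact_coordBall 3).measurableSet h2, integral_const_mul, key,
      mul_zero]

/-! ### Degenerate ellipsoids and reflection -/

theorem volume_real_disc {S : ℝ} (hS : 0 ≤ S) :
    volume.real {y : Fin 2 → ℝ | ∑ j, y j ^ 2 ≤ S} = Real.pi * S := by
  have h1 : (WithLp.ofLp : EuclideanSpace ℝ (Fin 2) → Fin 2 → ℝ) ⁻¹' {y : Fin 2 → ℝ | ∑ j, y j ^ 2 ≤ S} =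
      Metric.closedBall 0 (√S) := by
    ext y
    rw [mem_closedBall_zero_iff, EuclideanSpace.norm_eq, Real.sqrt_le_sqrt_iff hS]
    simp
  rw [measureReal_def, ← (PiLp.volume_preserving_ofLp (Fin 2)).measure_preimage
    (measurableSet_le (by fun_prop) (by fun_prop)).nullMeasurableSet, h1,
    EuclideanSpace.volume_closedBall_fin_two, ← ENNReal.ofReal_pow (Real.sqrt_nonneg _),
    Real.sq_sqrt hS, ENNReal.toReal_mul, ENNReal.toReal_ofReal hS]
  simp [mul_comm, Real.pi_nonneg]

/-- The attraction of the degenerate ellipsoid with vanishing horizontal semiaxes. -/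
theorem ballAttraction_focal (c : Fin 3 → ℂ) (κ : ℂ)
    (hs : ∀ U ∈ coordBall 3, ∑ j, axisScale c ![0, 0, κ] U j ^ 2 ∈ Complex.slitPlane) :
    ballAttraction c ![0, 0, κ] = Real.pi * ∫ s in (-1 : ℝ)..1,
      (1 - (s : ℂ) ^ 2) * newtonKernel ![c 0, c 1, c 2 + κ * s] := by
  have hc : Continuous (axisScale c ![0, 0, κ]) := by
    unfold axisScale
    fun_prop
  rw [ballAttraction, setIntegral_coordBall_eq_slices (n := 2) 2
    (F := fun U => newtonKernel (axisScale c ![0, 0, κ] U))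
    (continuousOn_newtonKernel.comp hc.continuousOn hs)]
  have h1 : ∀ (s : ℝ) (y : Fin 2 → ℝ), axisScale c ![0, 0, κ]
      ((2 : Fin 3).insertNth (α := fun _ => ℝ) s y) = ![c 0, c 1, c 2 + κ * s] := by
    intro s y
    ext j
    fin_cases j
    · simp [axisScale]
    · simp [axisScale]
    · have : (2 : Fin 3).insertNth (α := fun _ => ℝ) s y 2 = s := Fin.insertNth_apply_same ..
      simp [axisScale]
  simp only [h1, setIntegral_const]
  -- The integrand depends only on the height `s`, so each slice contributes the area `π(1 - s²)` of
  -- its disc; for `|s| > 1` the slice is empty.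
  rw [← setIntegral_eq_integral_of_forall_compl_eq_zero (s := Set.Icc (-1 : ℝ) 1)]
  · rw [intervalIntegral.integral_of_le (by norm_num), ← integral_Icc_eq_integral_Ioc,
      ← integral_const_mul]
    refine setIntegral_congr_fun measurableSet_Icc fun s hs => ?_
    have h2 : 0 ≤ 1 - s ^ 2 := by nlinarith [hs.1, hs.2]
    simp only [volume_real_disc h2, Complex.real_smul]
    push_cast
    ring
  · intro s hs
    have h2 : 1 - s ^ 2 < 0 := by
      rw [Set.mem_Icc, ← abs_le, not_le] at hs
      nlinarith [sq_abs s, abs_nonneg s]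
    have h3 : {y : Fin 2 → ℝ | ∑ j, y j ^ 2 ≤ 1 - s ^ 2} = ∅ := by
      ext y
      simp only [Set.mem_ofPred_eq, Set.mem_empty_iff_false, iff_false, not_le]
      exact h2.trans_le (Finset.sum_nonneg fun j _ => sq_nonneg _)
    rw [h3]
    simp

/-- With all semiaxes zero the kernel is constant; the factor is the volume of the unit ball. -/
theorem ballAttraction_zero (c : Fin 3 → ℂ) (hc : ∑ j, c j ^ 2 ∈ Complex.slitPlane) :
    ballAttraction c ![0, 0, 0] = 4 / 3 * Real.pi * newtonKernel c := by
  rw [ballAttraction_focal c 0]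
  · have h1 : ![c 0, c 1, c 2 + 0] = c := by
      ext j
      fin_cases j <;> simp
    simp only [zero_mul, h1]
    rw [intervalIntegral.integral_mul_const]
    have h2 : ∫ s in (-1 : ℝ)..1, (1 - (s : ℂ) ^ 2) = ((∫ s in (-1 : ℝ)..1, (1 - s ^ 2) : ℝ) : ℂ) := by
      rw [← intervalIntegral.integral_ofReal]
      simp
    rw [h2]
    norm_num
    ring
  · intro U _
    convert hc using 3 with j
    fin_cases j <;> simp [axisScale]

theorem newtonKernel_neg {p q : Fin 3 → ℂ} (h0 : p 0 = q 0) (h1 : p 1 = q 1) (h2 : p 2 = -q 2) :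
    newtonKernel p = -newtonKernel q := by
  simp [newtonKernel, Fin.sum_univ_three, h0, h1, h2]

/-- The reflection `U₂ ↦ -U₂` preserves the ball, and the kernel is odd in its last coordinate. -/
theorem ballAttraction_neg (X Y z : ℂ) (A : Fin 3 → ℂ)
    (hs : ∀ U ∈ coordBall 3, ∑ j, axisScale ![X, Y, z] A U j ^ 2 ∈ Complex.slitPlane)
    (hs' : ∀ U ∈ coordBall 3, ∑ j, axisScale ![X, Y, -z] A U j ^ 2 ∈ Complex.slitPlane) :
    ballAttraction ![X, Y, -z] A = -ballAttraction ![X, Y, z] A := by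
  have hc : ∀ c, Continuous (axisScale c A) := fun c => by
    unfold axisScale
    fun_prop
  rw [ballAttraction, ballAttraction, setIntegral_coordBall_eq_slices (n := 2) 2
    (F := fun U => newtonKernel (axisScale ![X, Y, z] A U))
    (continuousOn_newtonKernel.comp (hc _).continuousOn hs), setIntegral_coordBall_eq_slices (n := 2) 2
    (F := fun U => newtonKernel (axisScale ![X, Y, -z] A U))
    (continuousOn_newtonKernel.comp (hc _).continuousOn hs'), ← integral_neg_eq_self,
    ← integral_neg]
  refine integral_congr_ae (.of_forall fun s => ?_)
  simp only [neg_sq]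
  rw [← integral_neg]
  refine integral_congr_ae (.of_forall fun y => ?_)
  refine newtonKernel_neg ?_ ?_ ?_
  · rfl
  · rfl
  · have : ∀ s, (2 : Fin 3).insertNth (α := fun _ => ℝ) s y 2 = s :=
      fun s => Fin.insertNth_apply_same ..
    simp [axisScale]
    ring

/-! ### The focal segment integral -/

/-- Off the cut the argument is not `π`, so half of it lies strictly between `-π/2` and `π/2`. In
the oblate case this keeps the argument of the logarithm off the cut. -/
theorem re_cpow_half_pos {z : ℂ} (hz : z ∈ Complex.slitPlane) : 0 < (z ^ (1 / 2 : ℂ)).re := by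
  have h0 := Complex.slitPlane_ne_zero hz
  rw [Complex.mem_slitPlane_iff_arg] at hz
  rw [Complex.cpow_def_of_ne_zero h0, Complex.exp_re]
  refine mul_pos (Real.exp_pos _) (Real.cos_pos_of_mem_Ioo ?_)
  have h1 : (Complex.log z * (1 / 2)).im = z.arg / 2 := by
    rw [show (1 / 2 : ℂ) = ((1 / 2 : ℝ) : ℂ) by norm_num, Complex.im_mul_ofReal, Complex.log_im]
    ring
  rw [h1]
  constructor
  · linarith [Complex.neg_pi_lt_arg z]
  · linarith [lt_of_le_of_ne (Complex.arg_le_pi z) hz.1]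

/-- The attraction of the focal segment by the weight `1 - s ^ 2`. -/
theorem integral_focal_segment (R z κ : ℂ) (hκ : κ ≠ 0)
    (hD : ∀ s ∈ Set.Icc (-1 : ℝ) 1, R + (z + κ * s) ^ 2 ∈ Complex.slitPlane)
    (hS : ∀ s ∈ Set.Icc (-1 : ℝ) 1,
      z + κ * s + (R + (z + κ * s) ^ 2) ^ (1 / 2 : ℂ) ∈ Complex.slitPlane) :
    ∫ s in (-1 : ℝ)..1, (1 - (s : ℂ) ^ 2) * ((z + κ * s) * (R + (z + κ * s) ^ 2) ^ (-3 / 2 : ℂ)) =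
      2 / κ ^ 3 * (z * (Complex.log (z + κ + (R + (z + κ) ^ 2) ^ (1 / 2 : ℂ)) -
        Complex.log (z - κ + (R + (z - κ) ^ 2) ^ (1 / 2 : ℂ))) -
        ((R + (z + κ) ^ 2) ^ (1 / 2 : ℂ) - (R + (z - κ) ^ 2) ^ (1 / 2 : ℂ))) := by
  have hle : (-1 : ℝ) ≤ 1 := by norm_num
  -- With `ζ = z + κs` and `D = R + ζ²`, integrate by parts using `(D^(-1/2))' = -κζ D^(-3/2)`; the
  -- boundary term dies with `1 - s²`. In the remaining integral write `s = (ζ - z)/κ`: `ζ D^(-1/2)`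
  -- integrates to `D^(1/2)/κ`, and `D^(-1/2)` to `log(ζ + D^(1/2))/κ`.
  rw [intervalIntegral.integral_eq_sub_of_hasDerivAt (f := fun s : ℝ =>
    -(1 / κ) * ((1 - (s : ℂ) ^ 2) * (R + (z + κ * s) ^ 2) ^ (-1 / 2 : ℂ)) - 2 / κ ^ 3 *
      ((R + (z + κ * s) ^ 2) ^ (1 / 2 : ℂ) -
        z * Complex.log (z + κ * s + (R + (z + κ * s) ^ 2) ^ (1 / 2 : ℂ))))]
  · have h1 : z + κ * ((-1 : ℝ) : ℂ) = z - κ := by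
      push_cast
      ring
    have h2 : z + κ * ((1 : ℝ) : ℂ) = z + κ := by simp
    simp only [h1, h2]
    push_cast
    ring
  · intro s hs
    rw [Set.uIcc_of_le hle] at hs
    have hs0 : HasDerivAt (fun s : ℝ => (s : ℂ)) 1 s := Complex.ofRealCLM.hasDerivAt
    have hζ : HasDerivAt (fun s : ℝ => z + κ * (s : ℂ)) κ s := by
      simpa using (hs0.const_mul κ).const_add z
    have hDd : HasDerivAt (fun s : ℝ => R + (z + κ * (s : ℂ)) ^ 2) (2 * (z + κ * s) * κ) s := by
      simpa using (hζ.pow 2).const_add R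
    have hpow : ∀ m : ℂ, HasDerivAt (fun s : ℝ => (R + (z + κ * (s : ℂ)) ^ 2) ^ m)
        (2 * (z + κ * s) * κ * (m * (R + (z + κ * s) ^ 2) ^ (m - 1))) s := fun m => by
      have h2 : HasDerivAt (fun w : ℂ => w ^ m) (m * (R + (z + κ * s) ^ 2) ^ (m - 1) * 1)
        (R + (z + κ * s) ^ 2) := (hasDerivAt_id _).cpow_const (hD s hs)
      have h3 := HasDerivAt.scomp s h2 hDd
      rw [mul_one, smul_eq_mul] at h3
      exact h3
    have hlog := (hζ.add (hpow (1 / 2))).clog_real (hS s hs)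
    have h := ((((hs0.pow 2).const_sub 1).mul (hpow (-1 / 2))).const_mul (-(1 / κ))).sub
      (((hpow (1 / 2)).sub (hlog.const_mul z)).const_mul (2 / κ ^ 3))
    refine h.congr_deriv ?_
    have hD0 := Complex.slitPlane_ne_zero (hD s hs)
    have hS0 := Complex.slitPlane_ne_zero (hS s hs)
    have e1 : (R + (z + κ * s) ^ 2) ^ (1 / 2 : ℂ) =
        (R + (z + κ * s) ^ 2) * (R + (z + κ * s) ^ 2) ^ (-1 / 2 : ℂ) := by
      rw [show (1 / 2 : ℂ) = 1 + -1 / 2 by norm_num, Complex.cpow_add _ _ hD0, Complex.cpow_one]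
    have e2 : (R + (z + κ * s) ^ 2) * ((R + (z + κ * s) ^ 2) ^ (-1 / 2 : ℂ)) ^ 2 = 1 := by
      rw [← Complex.cpow_nat_mul]
      norm_num
      rw [Complex.cpow_neg_one, mul_inv_cancel₀ hD0]
    simp only [show (1 / 2 - 1 : ℂ) = -1 / 2 by norm_num,
      show (-1 / 2 - 1 : ℂ) = -3 / 2 by norm_num, Pi.add_apply, e1] at hS0 ⊢
    have e3 : (κ + 2 * (z + κ * s) * κ * (1 / 2 * (R + (z + κ * s) ^ 2) ^ (-1 / 2 : ℂ))) /
        (z + κ * s + (R + (z + κ * s) ^ 2) * (R + (z + κ * s) ^ 2) ^ (-1 / 2 : ℂ)) =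
        κ * (R + (z + κ * s) ^ 2) ^ (-1 / 2 : ℂ) := by
      rw [div_eq_iff hS0]
      linear_combination (-κ) * e2
    rw [e3]
    field_simp
    simp
    ring
  · refine ContinuousOn.intervalIntegrable ?_
    rw [Set.uIcc_of_le hle]
    have : ContinuousOn (fun s : ℝ => (R + (z + κ * s) ^ 2) ^ (-3 / 2 : ℂ)) (Set.Icc (-1) 1) :=
      ContinuousOn.cpow_const (by fun_prop) hD
    fun_prop

/-! ### Real spheroids with an exterior point, and the sphere -/

/-- The point at displacement `-(X, Y, z)` from the centre lies outside the solid spheroid with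
equatorial semiaxis `a` and vertical semiaxis `c`. -/
def IsExteriorDisplacement (X Y z a c : ℝ) : Prop :=
  ∀ U ∈ coordBall 3, 0 < (X + a * U 0) ^ 2 + (Y + a * U 1) ^ 2 + (z + c * U 2) ^ 2

/-- Shrinking the semiaxes keeps the spheroid inside the original one, so the point stays exterior
along a whole confocal path, including its degenerate end. -/
theorem IsExteriorDisplacement.mono {X Y z a c a' c' : ℝ} (h : IsExteriorDisplacement X Y z a c)
    (ha : 0 < a) (hc : 0 < c) (ha' : |a'| ≤ a) (hc' : |c'| ≤ c) :
    IsExteriorDisplacement X Y z a' c' := by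
  intro U hU
  have e1 : (a' / a) ^ 2 ≤ 1 := by
    rw [sq_le_one_iff_abs_le_one, abs_div, abs_of_pos ha]
    exact (div_le_one ha).2 ha'
  have e2 : (c' / c) ^ 2 ≤ 1 := by
    rw [sq_le_one_iff_abs_le_one, abs_div, abs_of_pos hc]
    exact (div_le_one hc).2 hc'
  have hU' : ![a' / a * U 0, a' / a * U 1, c' / c * U 2] ∈ coordBall 3 := by
    simp only [coordBall, Fin.sum_univ_three, Set.mem_ofPred_eq] at hU ⊢
    simp only [Matrix.cons_val, mul_pow]
    nlinarith [mul_le_mul_of_nonneg_right e1 (sq_nonneg (U 0)),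
      mul_le_mul_of_nonneg_right e1 (sq_nonneg (U 1)),
      mul_le_mul_of_nonneg_right e2 (sq_nonneg (U 2))]
  have := h _ hU'
  simp only [Matrix.cons_val] at this
  rwa [← mul_assoc, ← mul_assoc, ← mul_assoc, mul_div_cancel₀ _ ha.ne',
    mul_div_cancel₀ _ hc.ne'] at this

theorem IsExteriorDisplacement.neg {X Y z a c : ℝ} (h : IsExteriorDisplacement X Y z a c) :
    IsExteriorDisplacement X Y (-z) a c := by
  intro U hU
  have hU' : ![U 0, U 1, -U 2] ∈ coordBall 3 := by
    simp only [coordBall, Fin.sum_univ_three, Set.mem_ofPred_eq] at hU ⊢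
    simpa using hU
  have := h _ hU'
  simp only [Matrix.cons_val] at this
  nlinarith

theorem sum_axisScale_sq (X Y z a c : ℝ) (U : Fin 3 → ℝ) :
    ∑ j, axisScale ![X, Y, z] ![a, a, c] U j ^ 2 =
      (((X + a * U 0) ^ 2 + (Y + a * U 1) ^ 2 + (z + c * U 2) ^ 2 : ℝ) : ℂ) := by
  simp [axisScale, Fin.sum_univ_three]

theorem IsExteriorDisplacement.mem_slitPlane {X Y z a c : ℝ}
    (h : IsExteriorDisplacement X Y z a c) {U : Fin 3 → ℝ} (hU : U ∈ coordBall 3) :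
    ∑ j, axisScale ![X, Y, z] ![a, a, c] U j ^ 2 ∈ Complex.slitPlane := by
  rw [sum_axisScale_sq, Complex.ofReal_mem_slitPlane]
  exact h U hU

/-- It suffices to compute the attraction on one side of the equatorial plane. -/
theorem ballAttraction_eq_of_pos {X Y z a c K : ℝ} (h : IsExteriorDisplacement X Y z a c)
    (hpos : ∀ z' : ℝ, 0 < z' → z' ^ 2 = z ^ 2 → IsExteriorDisplacement X Y z' a c →
      ballAttraction ![X, Y, z'] ![a, a, c] = K * z') :
    ballAttraction ![X, Y, z] ![a, a, c] = K * z := by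
  have hn : ballAttraction ![X, Y, -z] ![a, a, c] = -ballAttraction ![X, Y, z] ![a, a, c] :=
    ballAttraction_neg X Y z _ (fun U hU => h.mem_slitPlane hU) fun U hU => by
      have := h.neg.mem_slitPlane hU
      rwa [Complex.ofReal_neg] at this
  rcases lt_trichotomy z 0 with hz | rfl | hz
  · have := hpos (-z) (by linarith) (neg_sq z) h.neg
    rw [Complex.ofReal_neg, hn] at this
    linear_combination -this
  · rw [Complex.ofReal_zero, neg_zero] at hn
    rw [Complex.ofReal_zero, mul_zero]
    linear_combination hn / 2
  · exact hpos z hz rfl h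

theorem ballAttraction_eq_of_confocal_real {X Y z a c : ℝ} (h : IsExteriorDisplacement X Y z a c)
    (ha : 0 < a) (hc : 0 < c) (u v u' v' : ℝ → ℝ) (hu : ∀ t, HasDerivAt u (u' t) t)
    (hv : ∀ t, HasDerivAt v (v' t) t) (hu' : Continuous u') (hv' : Continuous v')
    (huv : ∀ t, u t * u' t = v t * v' t) (hua : ∀ t ∈ Set.Icc (0 : ℝ) 1, |u t| ≤ a)
    (hvc : ∀ t ∈ Set.Icc (0 : ℝ) 1, |v t| ≤ c) :
    ballAttraction ![X, Y, z] ![u 0, u 0, v 0] = ballAttraction ![X, Y, z] ![u 1, u 1, v 1] := by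
  refine ballAttraction_eq_of_confocal _ (fun t => ![(u t : ℂ), (u t : ℂ), (v t : ℂ)])
    (fun t => ![(u' t : ℂ), (u' t : ℂ), (v' t : ℂ)]) (fun t => (u t * u' t : ℝ)) ?_ ?_ ?_ ?_
  · intro t i
    fin_cases i
    · exact (hu t).ofReal_comp
    · exact (hu t).ofReal_comp
    · exact (hv t).ofReal_comp
  · refine continuous_pi fun i => ?_
    fin_cases i <;> simp <;> fun_prop
  · intro t i
    fin_cases i
    · simp
    · simp
    · simp [huv t]
  · intro t ht U hU
    exact (h.mono ha hc (hua t ht) (hvc t ht)).mem_slitPlane hU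

/-- The attraction of a sphere. -/
theorem ballAttraction_sphere {X Y z a : ℝ} (ha : 0 < a) (h : IsExteriorDisplacement X Y z a a) :
    ballAttraction ![X, Y, z] ![a, a, a] =
      ((4 / 3 * Real.pi / √(X ^ 2 + Y ^ 2 + z ^ 2) ^ 3 : ℝ) : ℂ) * z := by
  -- Concentric spheres are confocal; the path shrinks the sphere to its centre.
  have hd : ∀ t : ℝ, HasDerivAt (fun t : ℝ => a * (1 - t)) (-a) t := fun t => by
    simpa using ((hasDerivAt_id t).const_sub 1).const_mul a
  have hle : ∀ t ∈ Set.Icc (0 : ℝ) 1, |a * (1 - t)| ≤ a := fun t ht => by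
    rw [abs_of_nonneg (mul_nonneg ha.le (by linarith [ht.2]))]
    nlinarith [ht.1]
  have h1 := ballAttraction_eq_of_confocal_real h ha ha _ _ _ _ hd hd continuous_const
    continuous_const (fun t => rfl) hle hle
  have h0 : 0 < X ^ 2 + Y ^ 2 + z ^ 2 := by
    simpa using h 0 (by simp [coordBall])
  have hsum : ∑ j, (![X, Y, z] : Fin 3 → ℂ) j ^ 2 = ((X ^ 2 + Y ^ 2 + z ^ 2 : ℝ) : ℂ) := by
    simp [Fin.sum_univ_three]
  simp only [sub_zero, mul_one, sub_self, mul_zero, Complex.ofReal_zero] at h1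
  rw [h1, ballAttraction_zero _ (by rw [hsum, Complex.ofReal_mem_slitPlane]; exact h0),
    newtonKernel, hsum, show (-3 / 2 : ℂ) = ((-3 / 2 : ℝ) : ℂ) by push_cast; rfl,
    ← Complex.ofReal_cpow h0.le]
  have h2 : (X ^ 2 + Y ^ 2 + z ^ 2) ^ (-3 / 2 : ℝ) = 1 / √(X ^ 2 + Y ^ 2 + z ^ 2) ^ 3 := by
    rw [Real.sqrt_eq_rpow, ← Real.rpow_mul_natCast h0.le, one_div, ← Real.rpow_neg h0.le]
    norm_num
  rw [h2]
  simp
  ring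

/-! ### The segment integral in confocal terms, and the prolate spheroid -/

/-- The attraction of the focal segment in terms of the vertical semiaxis `α` of the confocal
spheroid through the attracted point. -/
theorem integral_focal_segment_eq_log {R z α : ℝ} {κ : ℂ} (hκ : κ ≠ 0) (hα : 0 < α) (hz : 0 < z)
    (hconf : (α : ℂ) ^ 2 * (R + z ^ 2 + κ ^ 2) = α ^ 4 + z ^ 2 * κ ^ 2)
    (hre : 0 < (α + z * κ / α : ℂ).re) (hre' : 0 < (α - z * κ / α : ℂ).re)
    (hD : ∀ s ∈ Set.Icc (-1 : ℝ) 1, (R + (z + κ * s) ^ 2 : ℂ) ∈ Complex.slitPlane)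
    (hS : ∀ s ∈ Set.Icc (-1 : ℝ) 1,
      (z + κ * s + (R + (z + κ * s) ^ 2) ^ (1 / 2 : ℂ) : ℂ) ∈ Complex.slitPlane) :
    ∫ s in (-1 : ℝ)..1, (1 - (s : ℂ) ^ 2) * ((z + κ * s) * (R + (z + κ * s) ^ 2) ^ (-3 / 2 : ℂ)) =
      2 * z / κ ^ 3 * (Complex.log (α + κ) - Complex.log (α - κ) - 2 * κ / α) := by
  have hα' : (α : ℂ) ≠ 0 := Complex.ofReal_ne_zero.2 hα.ne'
  have hp : 0 < (α + z) / α := by positivity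
  -- By `hconf` the right side squares to `R + (z + κ)²`; its positive real part makes it the
  -- principal root.
  have e1 : (R + (z + κ) ^ 2 : ℂ) ^ (1 / 2 : ℂ) = α + z * κ / α := by
    rw [← Complex.sq_cpow_two_inv hre, one_div]
    congr 1
    field_simp
    linear_combination hconf
  have e2 : (R + (z - κ) ^ 2 : ℂ) ^ (1 / 2 : ℂ) = α - z * κ / α := by
    rw [← Complex.sq_cpow_two_inv hre', one_div]
    congr 1
    field_simp
    linear_combination hconf
  -- Both logarithm arguments contain the factor `(α + z)/α`. It is real and positive because `z >
  -- 0`, so it splits off without a branch correction and cancels in the difference.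
  have f1 : z + κ + (α + z * κ / α) = (α + κ) * (((α + z) / α : ℝ) : ℂ) := by
    push_cast
    field_simp
    ring
  have f2 : z - κ + (α - z * κ / α) = (α - κ) * (((α + z) / α : ℝ) : ℂ) := by
    push_cast
    field_simp
    ring
  have g1 : (α + κ : ℂ) ≠ 0 := by
    have := Complex.slitPlane_ne_zero (hS 1 (by simp))
    rw [Complex.ofReal_one, mul_one, e1, f1] at this
    exact left_ne_zero_of_mul this
  have g2 : (α - κ : ℂ) ≠ 0 := by
    have := Complex.slitPlane_ne_zero (hS (-1) (by simp))
    rw [Complex.ofReal_neg, Complex.ofReal_one, mul_neg_one, ← sub_eq_add_neg, e2, f2] at this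
    exact left_ne_zero_of_mul this
  rw [integral_focal_segment R z κ hκ hD hS, e1, e2, f1, f2, Complex.log_mul_ofReal _ hp _ g1,
    Complex.log_mul_ofReal _ hp _ g2]
  field_simp
  ring

/-- One semiaxis `c(1 - t)` shrinks linearly to zero; the other is this square root, so the
difference of squares stays `f²` and the spheroids stay confocal. -/
theorem hasDerivAt_sqrt_confocal {f c : ℝ} (hf : 0 < f) (t : ℝ) :
    HasDerivAt (fun t : ℝ => √(f ^ 2 + (c * (1 - t)) ^ 2))
      (c * (1 - t) * -c / √(f ^ 2 + (c * (1 - t)) ^ 2)) t := by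
  have h1 : HasDerivAt (fun t : ℝ => c * (1 - t)) (-c) t := by
    simpa using ((hasDerivAt_id t).const_sub 1).const_mul c
  have h2 : HasDerivAt (fun t : ℝ => f ^ 2 + (c * (1 - t)) ^ 2) (2 * (c * (1 - t)) * -c) t := by
    simpa using (h1.pow 2).const_add (f ^ 2)
  refine (h2.sqrt (by positivity)).congr_deriv ?_
  have : √(f ^ 2 + (c * (1 - t)) ^ 2) ≠ 0 := (Real.sqrt_pos.2 (by positivity)).ne'
  field_simp

theorem abs_sqrt_confocal_le {f c a : ℝ} (ha : 0 < a) (hfc : a ^ 2 = f ^ 2 + c ^ 2) {t : ℝ}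
    (ht : t ∈ Set.Icc (0 : ℝ) 1) : |√(f ^ 2 + (c * (1 - t)) ^ 2)| ≤ a := by
  rw [abs_of_nonneg (Real.sqrt_nonneg _), Real.sqrt_le_left ha.le, hfc, mul_pow]
  have : (1 - t) ^ 2 ≤ 1 := by nlinarith [ht.1, ht.2]
  nlinarith [sq_nonneg c]

theorem sqrt_confocal_zero {f c a : ℝ} (ha : 0 < a) (hfc : a ^ 2 = f ^ 2 + c ^ 2) :
    √(f ^ 2 + (c * (1 - 0)) ^ 2) = a := by
  rw [sub_zero, mul_one, ← hfc, Real.sqrt_sq ha.le]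

theorem sqrt_confocal_one {f c : ℝ} (hf : 0 < f) : √(f ^ 2 + (c * (1 - 1)) ^ 2) = f := by
  rw [sub_self, mul_zero, zero_pow two_ne_zero, add_zero, Real.sqrt_sq hf.le]

theorem abs_mul_one_sub_le {a : ℝ} (ha : 0 < a) {t : ℝ} (ht : t ∈ Set.Icc (0 : ℝ) 1) :
    |a * (1 - t)| ≤ a := by
  rw [abs_of_nonneg (mul_nonneg ha.le (by linarith [ht.2]))]
  nlinarith [ht.1]

theorem hasDerivAt_mul_one_sub (a t : ℝ) : HasDerivAt (fun t : ℝ => a * (1 - t)) (-a) t := by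
  simpa using ((hasDerivAt_id t).const_sub 1).const_mul a

theorem ballAttraction_focal_eq_integral (X Y z : ℝ) (κ : ℂ)
    (hs : ∀ U ∈ coordBall 3, ∑ j, axisScale ![X, Y, z] ![0, 0, κ] U j ^ 2 ∈ Complex.slitPlane) :
    ballAttraction ![X, Y, z] ![0, 0, κ] = Real.pi * ∫ s in (-1 : ℝ)..1,
      (1 - (s : ℂ) ^ 2) * ((z + κ * s) * (((X ^ 2 + Y ^ 2 : ℝ) : ℂ) +
        (z + κ * s) ^ 2) ^ (-3 / 2 : ℂ)) := by
  rw [ballAttraction_focal _ _ hs]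
  simp [newtonKernel, Fin.sum_univ_three]

theorem mem_slitPlane_of_focal {X Y z : ℝ} {κ : ℂ}
    (hs : ∀ U ∈ coordBall 3, ∑ j, axisScale ![X, Y, z] ![0, 0, κ] U j ^ 2 ∈ Complex.slitPlane)
    {s : ℝ} (h : s ∈ Set.Icc (-1 : ℝ) 1) :
    ((X ^ 2 + Y ^ 2 : ℝ) : ℂ) + (z + κ * s) ^ 2 ∈ Complex.slitPlane := by
  have := hs ![0, 0, s] (by
    simp only [coordBall, Fin.sum_univ_three, Set.mem_ofPred_eq]
    simp
    exact abs_le.2 h)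
  simpa [axisScale, Fin.sum_univ_three] using this

/-- The attraction of a prolate spheroid with semifocal distance `κ`; the confocal spheroid
through the attracted point has the squared semiaxes `T` and `T + κ ^ 2`. -/
theorem ballAttraction_prolate {X Y z a c κ T : ℝ} (ha : 0 < a) (hc : 0 < c) (hκ : 0 < κ)
    (hca : c ^ 2 = κ ^ 2 + a ^ 2) (h : IsExteriorDisplacement X Y z a c) (hT : 0 < T)
    (hconf : (T + κ ^ 2) * (T - (X ^ 2 + Y ^ 2)) = z ^ 2 * T) :
    ballAttraction ![X, Y, z] ![a, a, c] =
      ((4 * Real.pi / κ ^ 3 * (Real.log (κ / √T + √(1 + (κ / √T) ^ 2)) -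
        κ / √T / √(1 + (κ / √T) ^ 2)) : ℝ) : ℂ) * z := by
  refine ballAttraction_eq_of_pos h fun w hw hwz h => ?_
  rw [← hwz] at hconf
  have hκc : κ ≤ c := by nlinarith
  have h1 := ballAttraction_eq_of_confocal_real h ha hc (fun t => a * (1 - t))
    (fun t => √(κ ^ 2 + (a * (1 - t)) ^ 2)) _ _ (hasDerivAt_mul_one_sub a)
    (hasDerivAt_sqrt_confocal hκ) continuous_const
    (by
      have : ∀ t : ℝ, √(κ ^ 2 + (a * (1 - t)) ^ 2) ≠ 0 :=
        fun t => (Real.sqrt_pos.2 (by positivity)).ne'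
      fun_prop (disch := assumption))
    (fun t => by
      have : √(κ ^ 2 + (a * (1 - t)) ^ 2) ≠ 0 := (Real.sqrt_pos.2 (by positivity)).ne'
      field_simp)
    (fun t ht => abs_mul_one_sub_le ha ht) (fun t ht => abs_sqrt_confocal_le hc hca ht)
  beta_reduce at h1
  rw [sqrt_confocal_zero hc hca, sqrt_confocal_one hκ, sub_zero, mul_one, sub_self, mul_zero,
    Complex.ofReal_zero] at h1
  have hf : IsExteriorDisplacement X Y w 0 κ :=
    h.mono ha hc (by simpa using ha.le) (by rwa [abs_of_pos hκ])
  have hs : ∀ U ∈ coordBall 3,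
      ∑ j, axisScale ![X, Y, w] ![0, 0, (κ : ℂ)] U j ^ 2 ∈ Complex.slitPlane := fun U hU => by
    have := hf.mem_slitPlane hU
    rwa [Complex.ofReal_zero] at this
  have hDpos : ∀ s ∈ Set.Icc (-1 : ℝ) 1, 0 < X ^ 2 + Y ^ 2 + (w + κ * s) ^ 2 := fun s hs' => by
    have := mem_slitPlane_of_focal hs hs'
    rw [← Complex.ofReal_mem_slitPlane]
    push_cast at this ⊢
    exact this
  have hTκ : 0 < T + κ ^ 2 := by positivity
  set α := √(T + κ ^ 2) with hαdef
  have hα : 0 < α := Real.sqrt_pos.2 hTκ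
  have hα2 : α ^ 2 = T + κ ^ 2 := Real.sq_sqrt hTκ.le
  have hκα : κ < α := by nlinarith
  -- A point of the confocal spheroid is no higher than its vertical semiaxis. With `κ < α` this
  -- makes `α - wκ/α` positive, as the choice of square root requires.
  have hwα : w ≤ α := by
    have : w ^ 2 * T ≤ α ^ 2 * T := by
      rw [← hconf, hα2]
      nlinarith [mul_nonneg hTκ.le (add_nonneg (sq_nonneg X) (sq_nonneg Y))]
    have := le_of_mul_le_mul_right this hT
    nlinarith
  have hwκ : w * κ / α < α := by
    rw [div_lt_iff₀ hα]
    nlinarith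
  rw [h1, ballAttraction_focal_eq_integral X Y w κ hs,
    integral_focal_segment_eq_log (α := α) (Complex.ofReal_ne_zero.2 hκ.ne') hα hw]
  · have e1 : Complex.log (α + κ) - Complex.log (α - κ) =
        ((Real.log (α + κ) - Real.log (α - κ) : ℝ) : ℂ) := by
      rw [← Complex.ofReal_add, ← Complex.ofReal_sub, ← Complex.ofReal_log (by positivity),
        ← Complex.ofReal_log (by linarith), Complex.ofReal_sub]
    have hT' : 0 < √T := Real.sqrt_pos.2 hT
    have hTsq : √T ^ 2 = T := Real.sq_sqrt hT.le
    have e2 : √(1 + (κ / √T) ^ 2) = α / √T := by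
      rw [hαdef, ← Real.sqrt_div hTκ.le, div_pow, hTsq]
      congr 1
      field_simp
    -- Since `(α + κ)(α - κ) = T`, the quotient `(α + κ)/(α - κ)` equals `((α + κ)/√T)²`.
    have e3 : Real.log (α + κ) - Real.log (α - κ) = 2 * Real.log (κ / √T + α / √T) := by
      rw [← Real.log_div (by positivity) (by linarith), ← Nat.cast_ofNat (n := 2) (R := ℝ),
        ← Real.log_pow]
      congr 1
      have : α - κ ≠ 0 := by linarith
      rw [← add_div, div_pow, hTsq]
      field_simp
      linear_combination -(α + κ) * hα2
    rw [e1, e3, e2]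
    push_cast
    have : (α : ℂ) ≠ 0 := Complex.ofReal_ne_zero.2 hα.ne'
    have : (√T : ℂ) ≠ 0 := Complex.ofReal_ne_zero.2 hT'.ne'
    field_simp
    ring
  · norm_cast
    linear_combination (X ^ 2 + Y ^ 2 + w ^ 2 - T - α ^ 2) * hα2 - hconf
  · rw [← Complex.ofReal_mul, ← Complex.ofReal_div, ← Complex.ofReal_add, Complex.ofReal_re]
    positivity
  · rw [← Complex.ofReal_mul, ← Complex.ofReal_div, ← Complex.ofReal_sub, Complex.ofReal_re]
    linarith
  · exact fun s hs' => mem_slitPlane_of_focal hs hs'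
  · intro s hs'
    have e : (w + κ * s + (((X ^ 2 + Y ^ 2 : ℝ) : ℂ) + (w + κ * s) ^ 2) ^ (1 / 2 : ℂ) : ℂ) =
        ((w + κ * s + √(X ^ 2 + Y ^ 2 + (w + κ * s) ^ 2) : ℝ) : ℂ) := by
      rw [Real.sqrt_eq_rpow]
      push_cast [Complex.ofReal_cpow (hDpos s hs').le]
      rfl
    rw [e, Complex.ofReal_mem_slitPlane]
    rcases lt_or_ge 0 (w + κ * s) with hpos | hneg
    · positivity
    -- If `w + κs ≤ 0` for some `s ≥ -1`, then `-w/κ` lies in `[-1, 1]`: the segment reaches the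
    -- height of the point, and exteriority there forces it off the axis. Then `√D > |w + κs|`.
    · have hR : 0 < X ^ 2 + Y ^ 2 := by
        have := hDpos (-w / κ) ⟨?_, ?_⟩
        · rw [mul_div_cancel₀ _ hκ.ne'] at this
          simpa using this
        · rw [le_div_iff₀ hκ]
          nlinarith [hs'.1]
        · rw [div_le_iff₀ hκ]
          linarith
      have := Real.lt_sqrt_of_sq_lt (x := -(w + κ * s)) (y := X ^ 2 + Y ^ 2 + (w + κ * s) ^ 2)
        (by rw [neg_sq]; linarith)
      linarith

/-! ### The oblate spheroid through an imaginary focal segment -/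

/-- The imaginary part `2zvU₂` vanishes only if `vU₂ = 0`, and then the real part is at least `z² >
0`. Hence points with `z = 0` are treated separately, by oddness. -/
theorem mem_slitPlane_of_imaginary (X Y u v : ℝ) {z : ℝ} (hz : z ≠ 0) (U : Fin 3 → ℝ) :
    ∑ j, axisScale ![X, Y, z] ![u, u, v * Complex.I] U j ^ 2 ∈ Complex.slitPlane := by
  have e : ∑ j, axisScale ![X, Y, z] ![u, u, v * Complex.I] U j ^ 2 =
      (((X + u * U 0) ^ 2 + (Y + u * U 1) ^ 2 + z ^ 2 - (v * U 2) ^ 2 : ℝ) : ℂ) +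
        ((2 * z * (v * U 2) : ℝ) : ℂ) * Complex.I := by
    simp [axisScale, Fin.sum_univ_three]
    linear_combination (v * U 2 : ℂ) ^ 2 * Complex.I_sq
  rw [e, Complex.mem_slitPlane_iff]
  by_cases h0 : v * U 2 = 0
  · left
    rw [h0]
    simp only [Complex.add_re, Complex.ofReal_re, Complex.re_ofReal_mul, Complex.I_re]
    have := sq_pos_of_ne_zero hz
    nlinarith [sq_nonneg (X + u * U 0), sq_nonneg (Y + u * U 1)]
  · right
    simp only [Complex.add_im, Complex.ofReal_im, Complex.im_ofReal_mul, Complex.I_im, zero_add,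
      mul_one]
    exact mul_ne_zero (mul_ne_zero two_ne_zero hz) h0

/-- The focal disc attracts like the imaginary focal segment. -/
theorem ballAttraction_disc_eq_focal (X Y f : ℝ) {z : ℝ} (hz : z ≠ 0) :
    ballAttraction ![X, Y, z] ![f, f, 0] = ballAttraction ![X, Y, z] ![0, 0, f * Complex.I] := by
  have hlin : ∀ t : ℝ, HasDerivAt (fun t : ℝ => Real.pi / 2 * t) (Real.pi / 2) t := fun t => by
    simpa using (hasDerivAt_id t).const_mul (Real.pi / 2)
  have hcos : ∀ t : ℝ, HasDerivAt (fun t : ℝ => ((f * Real.cos (Real.pi / 2 * t) : ℝ) : ℂ))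
      ((f * (-Real.sin (Real.pi / 2 * t) * (Real.pi / 2)) : ℝ) : ℂ) t := fun t =>
    ((hlin t).cos.const_mul f).ofReal_comp
  have hsin : ∀ t : ℝ,
      HasDerivAt (fun t : ℝ => ((f * Real.sin (Real.pi / 2 * t) : ℝ) : ℂ) * Complex.I)
      (((f * (Real.cos (Real.pi / 2 * t) * (Real.pi / 2)) : ℝ) : ℂ) * Complex.I) t := fun t =>
    (((hlin t).sin.const_mul f).ofReal_comp).mul_const Complex.I
  -- The squared semiaxes `f² cos²` and `-f² sin²` differ by `f²` throughout, so the path is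
  -- confocal, leading from the disc to the imaginary segment.
  have key := ballAttraction_eq_of_confocal ![X, Y, z]
    (fun t => ![((f * Real.cos (Real.pi / 2 * t) : ℝ) : ℂ),
      ((f * Real.cos (Real.pi / 2 * t) : ℝ) : ℂ),
      ((f * Real.sin (Real.pi / 2 * t) : ℝ) : ℂ) * Complex.I])
    (fun t => ![((f * (-Real.sin (Real.pi / 2 * t) * (Real.pi / 2)) : ℝ) : ℂ),
      ((f * (-Real.sin (Real.pi / 2 * t) * (Real.pi / 2)) : ℝ) : ℂ),
      ((f * (Real.cos (Real.pi / 2 * t) * (Real.pi / 2)) : ℝ) : ℂ) * Complex.I])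
    (fun t => ((f * Real.cos (Real.pi / 2 * t) *
      (f * (-Real.sin (Real.pi / 2 * t) * (Real.pi / 2))) : ℝ) : ℂ)) ?_ ?_ ?_ ?_
  · simpa using key
  · intro t i
    fin_cases i
    · exact hcos t
    · exact hcos t
    · exact hsin t
  · refine continuous_pi fun i => ?_
    fin_cases i <;> simp <;> fun_prop
  · intro t i
    fin_cases i
    · simp
    · simp
    · simp
      ring_nf
      simp
      ring
  · intro t _ U hU
    exact mem_slitPlane_of_imaginary X Y _ _ hz U

/-- The arguments are conjugate, so the difference is `2i` times the argument of `α + if`, an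
arctangent because `α > 0`. -/
theorem log_add_mul_I_sub_log_sub_mul_I {α f : ℝ} (hα : 0 < α) :
    Complex.log (α + f * Complex.I) - Complex.log (α - f * Complex.I) =
      2 * Real.arctan (f / α) * Complex.I := by
  have hre : (α + f * Complex.I : ℂ).re = α := by simp
  have him : (α + f * Complex.I : ℂ).im = f := by simp
  have harg : (α + f * Complex.I : ℂ).arg = Real.arctan (f / α) := by
    have h1 := abs_lt.1 (Complex.abs_arg_lt_pi_div_two_iff.2 (.inl (hre.symm ▸ hα)))
    rw [← Real.arctan_tan h1.1 h1.2, Complex.tan_arg, hre, him]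
  have hconj : (α - f * Complex.I : ℂ) = (starRingEnd ℂ) (α + f * Complex.I) := by
    simp [sub_eq_add_neg]
  rw [hconj, Complex.log_conj, Complex.sub_conj, Complex.log_im, harg]
  · push_cast
    ring
  · rw [harg]
    linarith [Real.arctan_lt_pi_div_two (f / α), Real.pi_pos]

/-- The attraction of an oblate spheroid with semifocal distance `f`; the confocal spheroid
through the attracted point has the squared semiaxes `T + f ^ 2` and `T`. -/
theorem ballAttraction_oblate {X Y z a c f T : ℝ} (ha : 0 < a) (hc : 0 < c) (hf : 0 < f)
    (hac : a ^ 2 = f ^ 2 + c ^ 2) (h : IsExteriorDisplacement X Y z a c) (hT : 0 < T)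
    (hconf : T * (X ^ 2 + Y ^ 2 + z ^ 2 - f ^ 2) = T ^ 2 - z ^ 2 * f ^ 2) :
    ballAttraction ![X, Y, z] ![a, a, c] =
      ((4 * Real.pi / f ^ 3 * (f / √T - Real.arctan (f / √T)) : ℝ) : ℂ) * z := by
  refine ballAttraction_eq_of_pos h fun w hw hwz h => ?_
  rw [← hwz] at hconf
  have h1 := ballAttraction_eq_of_confocal_real h ha hc
    (fun t => √(f ^ 2 + (c * (1 - t)) ^ 2)) (fun t => c * (1 - t)) _ _
    (hasDerivAt_sqrt_confocal hf) (hasDerivAt_mul_one_sub c)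
    (by
      have : ∀ t : ℝ, √(f ^ 2 + (c * (1 - t)) ^ 2) ≠ 0 :=
        fun t => (Real.sqrt_pos.2 (by positivity)).ne'
      fun_prop (disch := assumption))
    continuous_const
    (fun t => by
      have : √(f ^ 2 + (c * (1 - t)) ^ 2) ≠ 0 := (Real.sqrt_pos.2 (by positivity)).ne'
      field_simp)
    (fun t ht => abs_sqrt_confocal_le ha hac ht) (fun t ht => abs_mul_one_sub_le hc ht)
  beta_reduce at h1
  rw [sqrt_confocal_zero ha hac, sqrt_confocal_one hf, sub_zero, mul_one, sub_self, mul_zero,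
    Complex.ofReal_zero, ballAttraction_disc_eq_focal X Y f hw.ne'] at h1
  have hs : ∀ U ∈ coordBall 3, ∑ j, axisScale ![X, Y, w] ![0, 0, f * Complex.I] U j ^ 2 ∈
      Complex.slitPlane := fun U _ => by
    simpa using mem_slitPlane_of_imaginary X Y 0 f hw.ne' U
  set α := √T with hαdef
  have hα : 0 < α := Real.sqrt_pos.2 hT
  have hα2 : α ^ 2 = T := Real.sq_sqrt hT.le
  have hfI : (f * Complex.I : ℂ) ≠ 0 :=
    mul_ne_zero (Complex.ofReal_ne_zero.2 hf.ne') Complex.I_ne_zero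
  rw [h1, ballAttraction_focal_eq_integral X Y w _ hs,
    integral_focal_segment_eq_log (α := α) hfI hα hw]
  · rw [log_add_mul_I_sub_log_sub_mul_I hα]
    have : (α : ℂ) ≠ 0 := Complex.ofReal_ne_zero.2 hα.ne'
    have : (f : ℂ) ≠ 0 := Complex.ofReal_ne_zero.2 hf.ne'
    push_cast
    rw [mul_pow, Complex.I_pow_three]
    field_simp
    ring
  · rw [mul_pow, Complex.I_sq]
    have : α ^ 2 * (X ^ 2 + Y ^ 2 + w ^ 2 - f ^ 2) = α ^ 4 - w ^ 2 * f ^ 2 := by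
      rw [show α ^ 4 = (α ^ 2) ^ 2 by ring, hα2, hconf]
    have := congrArg (fun x : ℝ => (x : ℂ)) this
    push_cast at this ⊢
    linear_combination this
  · rw [show (α + w * (f * Complex.I) / α : ℂ) = α + ((w * f / α : ℝ) : ℂ) * Complex.I by
      push_cast; ring]
    simpa using hα
  · rw [show (α - w * (f * Complex.I) / α : ℂ) = α - ((w * f / α : ℝ) : ℂ) * Complex.I by
      push_cast; ring]
    simpa using hα
  · exact fun s hs' => mem_slitPlane_of_focal hs hs'
  · intro s hs'
    rw [Complex.mem_slitPlane_iff]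
    left
    -- The segment is displaced only in the imaginary direction, so `w + ifs` has real part `w > 0`;
    -- adding a principal square root stays in the right half-plane.
    have h2 := re_cpow_half_pos (mem_slitPlane_of_focal hs hs')
    have h3 : (w + f * Complex.I * s : ℂ).re = w := by simp
    rw [Complex.add_re, h3]
    positivity

/-! ### From the gravitational intensity to the integral over the ball -/

/-- The parametrization of the solid spheroid by the unit ball. -/
def spheroidMap (a c x₀ y₀ z₀ : ℝ) (U : Fin 3 → ℝ) : Fin 3 → ℝ :=
  fun i => ![x₀, y₀, z₀] i + ![a, a, c] i * U i

theorem spheroid_preimage_toLp {a c : ℝ} (ha : 0 < a) (hc : 0 < c) (x₀ y₀ z₀ : ℝ) :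
    WithLp.toLp 2 ⁻¹' spheroid a c !₂[x₀, y₀, z₀] =
      spheroidMap a c x₀ y₀ z₀ '' coordBall 3 := by
  ext q
  constructor
  · intro hq
    refine ⟨![(q 0 - x₀) / a, (q 1 - y₀) / a, (q 2 - z₀) / c], ?_, ?_⟩
    · simp only [coordBall, Fin.sum_univ_three, Set.mem_ofPred_eq]
      simpa [spheroid, ellipsoid, div_pow] using hq
    · ext i
      fin_cases i <;> simp [spheroidMap] <;> field_simp <;> ring
  · rintro ⟨U, hU, rfl⟩
    simp only [coordBall, Fin.sum_univ_three, Set.mem_ofPred_eq] at hU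
    simpa [spheroidMap, spheroid, ellipsoid, mul_pow, ha.ne', hc.ne'] using hU

theorem isCompact_spheroid {a c : ℝ} (ha : 0 < a) (hc : 0 < c) (x₀ y₀ z₀ : ℝ) :
    IsCompact (spheroid a c !₂[x₀, y₀, z₀]) := by
  have h1 : spheroid a c !₂[x₀, y₀, z₀] =
      WithLp.toLp 2 '' (spheroidMap a c x₀ y₀ z₀ '' coordBall 3) := by
    rw [← spheroid_preimage_toLp ha hc, Set.image_preimage_eq _ (WithLp.toLp_surjective 2)]
  rw [h1]
  refine ((isCompact_coordBall 3).image ?_).image (PiLp.continuous_toLp 2 _)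
  unfold spheroidMap
  fun_prop

theorem setIntegral_spheroid {a c : ℝ} (ha : 0 < a) (hc : 0 < c) (x₀ y₀ z₀ : ℝ)
    (F : EuclideanSpace ℝ (Fin 3) → ℝ) :
    ∫ Q in spheroid a c !₂[x₀, y₀, z₀], F Q =
      a ^ 2 * c * ∫ U in coordBall 3, F (WithLp.toLp 2 (spheroidMap a c x₀ y₀ z₀ U)) := by
  rw [← (PiLp.volume_preserving_toLp (Fin 3)).setIntegral_preimage_emb
    (MeasurableEquiv.toLp 2 (Fin 3 → ℝ)).measurableEmbedding, spheroid_preimage_toLp ha hc]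
  have hd : ∀ U ∈ coordBall 3, HasFDerivWithinAt (spheroidMap a c x₀ y₀ z₀)
      (LinearMap.toContinuousLinearMap (Matrix.toLin' (Matrix.diagonal ![a, a, c])))
      (coordBall 3) U := by
    intro U _
    refine HasFDerivAt.hasFDerivWithinAt ?_
    have := (LinearMap.toContinuousLinearMap
      (Matrix.toLin' (Matrix.diagonal ![a, a, c]))).hasFDerivAt (x := U)
    refine (this.const_add ![x₀, y₀, z₀]).congr_of_eventuallyEq (.of_forall fun V => ?_)
    ext i
    simp [spheroidMap, Matrix.mulVec_diagonal]
  have hinj : Set.InjOn (spheroidMap a c x₀ y₀ z₀) (coordBall 3) := by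
    intro U _ V _ h
    ext i
    have := congrFun h i
    fin_cases i <;> simpa [spheroidMap, ha.ne', hc.ne'] using this
  rw [integral_image_eq_integral_abs_det_fderiv_smul volume
    (isCompact_coordBall 3).measurableSet hd hinj, ← integral_const_mul]
  refine integral_congr_ae (.of_forall fun U => ?_)
  simp only [LinearMap.det_toContinuousLinearMap, LinearMap.det_toLin', Matrix.det_diagonal,
    Fin.prod_univ_three, Matrix.cons_val, smul_eq_mul]
  rw [abs_of_pos (by positivity), sq]

theorem continuousOn_newtonIntegrand_const (ρ : ℝ) {P : EuclideanSpace ℝ (Fin 3)}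
    {B : Set (EuclideanSpace ℝ (Fin 3))} (hP : P ∉ B) :
    ContinuousOn (newtonIntegrand (fun _ => ρ) P) B := by
  have h : ∀ Q ∈ B, ‖Q - P‖ ^ 3 ≠ 0 := fun Q hQ => by
    have : Q - P ≠ 0 := sub_ne_zero.2 fun h => hP (h ▸ hQ)
    positivity
  unfold newtonIntegrand
  fun_prop (disch := assumption)

theorem integrableOn_newtonIntegrand {a c x₀ y₀ z₀ : ℝ} (ha : 0 < a) (hc : 0 < c) (ρ : ℝ)
    {P : EuclideanSpace ℝ (Fin 3)} (hP : P ∉ spheroid a c !₂[x₀, y₀, z₀]) :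
    IntegrableOn (newtonIntegrand (fun _ => ρ) P) (spheroid a c !₂[x₀, y₀, z₀]) :=
  (continuousOn_newtonIntegrand_const ρ hP).integrableOn_compact (isCompact_spheroid ha hc _ _ _)

theorem one_lt_of_notMem_spheroid {a c x₀ y₀ z₀ x y : ℝ}
    (h : !₂[x, y, 0] ∉ spheroid a c !₂[x₀, y₀, z₀]) :
    1 < (x - x₀) ^ 2 / a ^ 2 + (y - y₀) ^ 2 / a ^ 2 + z₀ ^ 2 / c ^ 2 := by
  simpa [spheroid, ellipsoid] using h

/-- A vanishing displacement would exhibit `P` as the image of a point of the unit ball, hence as a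
point of the body. -/
theorem isExteriorDisplacement_of_notMem {a c x₀ y₀ z₀ x y : ℝ} (ha : 0 < a) (hc : 0 < c)
    (h : !₂[x, y, 0] ∉ spheroid a c !₂[x₀, y₀, z₀]) :
    IsExteriorDisplacement (x₀ - x) (y₀ - y) z₀ a c := by
  intro U hU
  by_contra! hle
  have s0 := sq_nonneg (x₀ - x + a * U 0)
  have s1 := sq_nonneg (y₀ - y + a * U 1)
  have s2 := sq_nonneg (z₀ + c * U 2)
  have h0 : x₀ - x + a * U 0 = 0 := by
    rw [← sq_eq_zero_iff]
    linarith
  have h1 : y₀ - y + a * U 1 = 0 := by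
    rw [← sq_eq_zero_iff]
    linarith
  have h2 : z₀ + c * U 2 = 0 := by
    rw [← sq_eq_zero_iff]
    linarith
  have hlt := one_lt_of_notMem_spheroid h
  rw [show x - x₀ = a * U 0 by linarith, show y - y₀ = a * U 1 by linarith,
    show z₀ = -(c * U 2) by linarith, neg_sq, mul_pow, mul_pow, mul_pow,
    mul_div_cancel_left₀ _ (by positivity), mul_div_cancel_left₀ _ (by positivity),
    mul_div_cancel_left₀ _ (by positivity)] at hlt
  simp only [coordBall, Fin.sum_univ_three, Set.mem_ofPred_eq] at hU
  linarith

theorem newtonKernel_axisScale {X Y z a c : ℝ} {U : Fin 3 → ℝ} :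
    newtonKernel (axisScale ![X, Y, z] ![a, a, c] U) =
      (((z + c * U 2) /
        √((X + a * U 0) ^ 2 + (Y + a * U 1) ^ 2 + (z + c * U 2) ^ 2) ^ 3 : ℝ) : ℂ) := by
  have h0 : 0 ≤ (X + a * U 0) ^ 2 + (Y + a * U 1) ^ 2 + (z + c * U 2) ^ 2 := by positivity
  have h1 : ∀ D : ℝ, 0 ≤ D → D ^ (-3 / 2 : ℝ) = 1 / √D ^ 3 := fun D hD => by
    rw [Real.sqrt_eq_rpow, ← Real.rpow_mul_natCast hD, one_div, ← Real.rpow_neg hD]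
    norm_num
  rw [newtonKernel, sum_axisScale_sq, show (-3 / 2 : ℂ) = ((-3 / 2 : ℝ) : ℂ) by push_cast; rfl,
    ← Complex.ofReal_cpow h0, h1 _ h0]
  simp [axisScale, div_eq_mul_inv]

/-- The vertical intensity of a homogeneous spheroid as an integral over the unit ball. -/
theorem ofReal_zIntensity {a c x₀ y₀ z₀ x y : ℝ} (ha : 0 < a) (hc : 0 < c) (γ ρ : ℝ)
    (h : !₂[x, y, 0] ∉ spheroid a c !₂[x₀, y₀, z₀]) :
    (zIntensity γ (fun _ => ρ) (spheroid a c !₂[x₀, y₀, z₀]) !₂[x, y, 0] : ℂ) =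
      γ * ρ * (a ^ 2 * c) *
        ballAttraction ![((x₀ - x : ℝ) : ℂ), ((y₀ - y : ℝ) : ℂ), z₀] ![a, a, c] := by
  have h1 : (∫ Q in spheroid a c !₂[x₀, y₀, z₀], newtonIntegrand (fun _ => ρ) !₂[x, y, 0] Q) 2 =
      ∫ Q in spheroid a c !₂[x₀, y₀, z₀], newtonIntegrand (fun _ => ρ) !₂[x, y, 0] Q 2 :=
    ((EuclideanSpace.proj (𝕜 := ℝ) (2 : Fin 3)).integral_comp_comm
      (integrableOn_newtonIntegrand ha hc ρ h)).symm
  rw [zIntensity, gravitationalIntensity, PiLp.smul_apply, h1, setIntegral_spheroid ha hc,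
    ballAttraction]
  simp only [newtonKernel_axisScale]
  rw [integral_complex_ofReal]
  have h2 : ∀ U, newtonIntegrand (fun _ => ρ) !₂[x, y, 0]
      (WithLp.toLp 2 (spheroidMap a c x₀ y₀ z₀ U)) 2 = ρ * ((z₀ + c * U 2) /
        √((x₀ - x + a * U 0) ^ 2 + (y₀ - y + a * U 1) ^ 2 + (z₀ + c * U 2) ^ 2) ^ 3) := by
    intro U
    rw [newtonIntegrand, EuclideanSpace.norm_eq]
    simp [Fin.sum_univ_three, spheroidMap]
    rw [show x₀ + a * U 0 - x = x₀ - x + a * U 0 by ring,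
      show y₀ + a * U 1 - y = y₀ - y + a * U 1 by ring]
    ring
  simp only [h2]
  rw [integral_const_mul, smul_eq_mul]
  push_cast
  ring

/-! ### The confocal parameters and the three cases -/

theorem quadratic_root_pos {b d : ℝ} (hd : 0 ≤ d) (h : d = 0 → 0 < b) :
    0 < (b + √(b ^ 2 + d)) / 2 := by
  rcases hd.eq_or_lt with h0 | h0
  · have := h h0.symm
    positivity
  · have h1 : |b| < √(b ^ 2 + d) := Real.lt_sqrt_of_sq_lt (by rw [sq_abs]; linarith)
    linarith [neg_abs_le b]

theorem quadratic_root_sq {b d : ℝ} (hd : 0 ≤ d) :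
    ((b + √(b ^ 2 + d)) / 2) ^ 2 = b * ((b + √(b ^ 2 + d)) / 2) + d / 4 := by
  have := Real.sq_sqrt (show 0 ≤ b ^ 2 + d by positivity)
  linear_combination this / 4

theorem mainTheorem2 (γ ρ a c x₀ y₀ z₀ x y ε r : ℝ) (ha : 0 < a) (hc : 0 < c)
    (hext : !₂[x, y, 0] ∉ spheroid a c !₂[x₀, y₀, z₀])
    (hε : ε = c / a) (hr : r = √((x - x₀) ^ 2 + (y - y₀) ^ 2 + z₀ ^ 2)) :
    0 < r ∧
    IntegrableOn (newtonIntegrand (fun _ => ρ) !₂[x, y, 0]) (spheroid a c !₂[x₀, y₀, z₀]) ∧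
    (ε < 1 → ∀ e q τ p : ℝ,
      e = √(1 - ε ^ 2) →
      q = e * a / r →
      τ = (1 - q ^ 2 + √((1 - q ^ 2) ^ 2 + 4 * q ^ 2 * z₀ ^ 2 / r ^ 2)) / 2 →
      p = q / √τ →
      0 < e ∧ 0 < τ ∧
      zIntensity γ (fun _ => ρ) (spheroid a c !₂[x₀, y₀, z₀]) !₂[x, y, 0] =
        4 * Real.pi * γ * ρ * (ε / e ^ 3) * (p - Real.arctan p) * z₀) ∧
    (1 < ε → ∀ e q t p : ℝ,
      e = √(ε ^ 2 - 1) →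
      q = e * a / r →
      t = (1 - q ^ 2 +
        √((1 - q ^ 2) ^ 2 + 4 * q ^ 2 * ((x - x₀) ^ 2 + (y - y₀) ^ 2) / r ^ 2)) / 2 →
      p = q / √t →
      0 < e ∧ 0 < t ∧
      zIntensity γ (fun _ => ρ) (spheroid a c !₂[x₀, y₀, z₀]) !₂[x, y, 0] =
        4 * Real.pi * γ * ρ * (ε / e ^ 3) *
          (Real.log (p + √(1 + p ^ 2)) - p / √(1 + p ^ 2)) * z₀) ∧
    (ε = 1 →
      zIntensity γ (fun _ => ρ) (spheroid a c !₂[x₀, y₀, z₀]) !₂[x, y, 0] =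
        4 / 3 * Real.pi * γ * ρ * a ^ 3 * (z₀ / r ^ 3)) := by
  have hdisp := isExteriorDisplacement_of_notMem ha hc hext
  have hlt := one_lt_of_notMem_spheroid hext
  have hr0 : 0 < (x - x₀) ^ 2 + (y - y₀) ^ 2 + z₀ ^ 2 := by
    have := hdisp 0 (by simp [coordBall])
    simp only [Pi.zero_apply, mul_zero, add_zero] at this
    linarith [sub_sq_comm x x₀, sub_sq_comm y y₀]
  have hrpos : 0 < r := hr ▸ Real.sqrt_pos.2 hr0
  have hr2 : r ^ 2 = (x - x₀) ^ 2 + (y - y₀) ^ 2 + z₀ ^ 2 := hr ▸ Real.sq_sqrt hr0.le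
  have hV := ofReal_zIntensity ha hc γ ρ hext
  have hεa : ε * a = c := by rw [hε, div_mul_cancel₀ _ ha.ne']
  have hε0 : 0 < ε := hε ▸ div_pos hc ha
  refine ⟨hrpos, integrableOn_newtonIntegrand ha hc ρ hext, ?_, ?_, ?_⟩
  · intro hε1 e q τ p he hq hτ hp
    have he0 : 0 < 1 - ε ^ 2 := by nlinarith
    have hepos : 0 < e := he ▸ Real.sqrt_pos.2 he0
    have he2 : e ^ 2 = 1 - ε ^ 2 := he ▸ Real.sq_sqrt he0.le
    have hf : 0 < e * a := by positivity
    have hqpos : 0 < q := hq ▸ div_pos hf hrpos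
    have hqr : q * r = e * a := by rw [hq, div_mul_cancel₀ _ hrpos.ne']
    have hac : a ^ 2 = (e * a) ^ 2 + c ^ 2 := by
      rw [mul_pow, he2, ← hεa]
      ring
    have hd : 0 ≤ 4 * q ^ 2 * z₀ ^ 2 / r ^ 2 := by positivity
    have hτpos : 0 < τ := by
      rw [hτ]
      -- The root can fail to be positive only if `z₀ = 0`. Then `P` is in the equatorial plane at
      -- distance `r > a > ea`, so `q < 1`.
      refine quadratic_root_pos hd fun h0 => ?_
      have hz : z₀ ^ 2 = 0 := by
        have : 4 * q ^ 2 ≠ 0 := by positivity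
        have : r ^ 2 ≠ 0 := by positivity
        simp_all
      rw [hz, zero_div, add_zero, ← add_div, lt_div_iff₀ (by positivity), one_mul] at hlt
      have : (q * r) ^ 2 < 1 * r ^ 2 := by
        rw [hqr, hr2, hz]
        nlinarith [sq_nonneg c]
      rw [mul_pow] at this
      linarith [lt_of_mul_lt_mul_right this (sq_nonneg r)]
    have hτ2 := quadratic_root_sq (b := 1 - q ^ 2) hd
    rw [← hτ] at hτ2
    -- `T = r²τ` is the squared vertical semiaxis of the confocal spheroid through `P`: the
    -- quadratic for `τ` times `r⁴` is the confocal equation with `f = ea = qr`.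
    have hT : 0 < r ^ 2 * τ := by positivity
    have hpT : e * a / √(r ^ 2 * τ) = p := by
      rw [Real.sqrt_mul (sq_nonneg r), Real.sqrt_sq hrpos.le, hp, hq, div_div]
    refine ⟨hepos, hτpos, ?_⟩
    rw [ballAttraction_oblate ha hc hf hac hdisp hT, hpT] at hV
    · norm_cast at hV
      rw [hV, ← hεa]
      field_simp
    · rw [sub_sq_comm x₀, sub_sq_comm y₀, ← hr2, ← hqr]
      field_simp at hτ2
      linear_combination -r ^ 2 * hτ2
  · intro hε1 e q t p he hq ht hp
    have he0 : 0 < ε ^ 2 - 1 := by nlinarith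
    have hepos : 0 < e := he ▸ Real.sqrt_pos.2 he0
    have he2 : e ^ 2 = ε ^ 2 - 1 := he ▸ Real.sq_sqrt he0.le
    have hκ : 0 < e * a := by positivity
    have hqpos : 0 < q := hq ▸ div_pos hκ hrpos
    have hqr : q * r = e * a := by rw [hq, div_mul_cancel₀ _ hrpos.ne']
    have hca : c ^ 2 = (e * a) ^ 2 + a ^ 2 := by
      rw [mul_pow, he2, ← hεa]
      ring
    have hd : 0 ≤ 4 * q ^ 2 * ((x - x₀) ^ 2 + (y - y₀) ^ 2) / r ^ 2 := by positivity
    have htpos : 0 < t := by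
      rw [ht]
      -- The critical case is `P` on the axis of revolution, where `r > c > ea` gives `q < 1`.
      refine quadratic_root_pos hd fun h0 => ?_
      have hR : (x - x₀) ^ 2 + (y - y₀) ^ 2 = 0 := by
        have h4 : 4 * q ^ 2 ≠ 0 := by positivity
        have h5 : r ^ 2 ≠ 0 := by positivity
        rw [div_eq_zero_iff] at h0
        exact (mul_eq_zero.1 (h0.resolve_right h5)).resolve_left h4
      rw [← add_div, hR, zero_div, zero_add, lt_div_iff₀ (by positivity), one_mul] at hlt
      have : (q * r) ^ 2 < 1 * r ^ 2 := by
        rw [hqr, hr2, hR]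
        nlinarith [sq_nonneg a]
      rw [mul_pow] at this
      linarith [lt_of_mul_lt_mul_right this (sq_nonneg r)]
    have ht2 := quadratic_root_sq (b := 1 - q ^ 2) hd
    rw [← ht] at ht2
    -- Here `T = r²t` is the squared equatorial semiaxis of the confocal spheroid through `P`.
    have hT : 0 < r ^ 2 * t := by positivity
    have hpT : e * a / √(r ^ 2 * t) = p := by
      rw [Real.sqrt_mul (sq_nonneg r), Real.sqrt_sq hrpos.le, hp, hq, div_div]
    refine ⟨hepos, htpos, ?_⟩
    rw [ballAttraction_prolate ha hc hκ hca hdisp hT, hpT] at hV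
    · norm_cast at hV
      rw [hV, ← hεa]
      field_simp
    · rw [sub_sq_comm x₀, sub_sq_comm y₀, ← hqr,
        show z₀ ^ 2 = r ^ 2 - ((x - x₀) ^ 2 + (y - y₀) ^ 2) by linarith]
      field_simp at ht2
      linear_combination r ^ 2 * ht2
  · intro hε1
    rw [hε1, one_mul] at hεa
    subst hεa
    rw [ballAttraction_sphere ha hdisp, sub_sq_comm x₀, sub_sq_comm y₀, ← hr] at hV
    norm_cast at hV
    rw [hV]
    field_simp
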